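/- Theorem. Let $H$ be a finite-dimensional Hopf algebra over a field $k$, with coproduct $\Delta$, counit $\varepsilon$ and antipode $S$, and let $R \subseteq H$ be a Hopf subalgebra (a subalgebra with $\Delta(R) \subseteq R \otimes R$ and $S(R) \subseteq R$). Put $R^+ = \{ r \in R : \varepsilon(r) = 0\}$ and let $Q = H/R^+H$ be the quotient right $H$-module. A right $H/R$-integral in $Q$ is an element $t \in Q$ with $t h = t\,\varepsilon(h)$ for all $h \in H$. The extension $H \supseteq R$ is an (ordinary, untwisted) Frobenius extension if there are an $R$-$R$-bimodule homomorphism $E : H \to R$ and finitely many elements $x_1,\dots,x_n, y_1,\dots,y_n \in H$ such that $\sum_i x_i E(y_i h) = h = \sum_i E(h x_i) y_i$ for all $h \in H$. For a finite-dimensional Hopf algebra $A$ over $k$, a right integral in $A$ is an element $t\in A$ with $t a = t\,\varepsilon(a)$ for all $a \in A$, and the right modular function of $A$ is the unique function $m_A : A \to k$ with $a t = m_A(a)\, t$ for all $a \in A$ and all right integrals $t$ in $A$. Then the right modular functions $m_H$ and $m_R$ are well defined (exist and are unique), and the following are equivalent: 1. $Q$ contains a nonzero right $H/R$-integral; 2.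 $H$ is a Frobenius extension of $R$; 3. $m_H|_R = m_R$. -/

import Mathlib

open scoped TensorProduct
open MulOpposite (op)

/-- A Hopf subalgebra of a Hopf algebra `H` over a field `k`: a subalgebra `R` with
`Δ(R) ⊆ R ⊗ R` (seen inside `H ⊗ H`) and `S(R) ⊆ R`. -/
structure HopfSubalgebra (k : Type*) (H : Type*) [Field k] [Ring H] [HopfAlgebra k H]
    extends Subalgebra k H where
  comul_mem' : ∀ h ∈ toSubalgebra, Coalgebra.comul (R := k) h ∈
    (Algebra.TensorProduct.map toSubalgebra.val toSubalgebra.val).range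
  antipode_mem' : ∀ h ∈ toSubalgebra, HopfAlgebra.antipode k h ∈ toSubalgebra

namespace HopfSubalgebra

variable {k : Type*} {H : Type*} [Field k] [Ring H] [HopfAlgebra k H]

/-- The canonical algebra map `R ⊗ R → H ⊗ H`. -/
noncomputable def tensorVal (R : HopfSubalgebra k H) :
    R.toSubalgebra ⊗[k] R.toSubalgebra →ₐ[k] H ⊗[k] H :=
  Algebra.TensorProduct.map R.toSubalgebra.val R.toSubalgebra.val

theorem tensorVal_injective (R : HopfSubalgebra k H) : Function.Injective R.tensorVal :=
  TensorProduct.map_injective_of_flat_flat R.toSubalgebra.val.toLinearMap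
    R.toSubalgebra.val.toLinearMap Subtype.val_injective Subtype.val_injective

/-- The coproduct of `R`, the restriction of that of `H`. -/
noncomputable def comulRestrict (R : HopfSubalgebra k H) :
    R.toSubalgebra →ₗ[k] R.toSubalgebra ⊗[k] R.toSubalgebra :=
  (LinearEquiv.ofInjective R.tensorVal.toLinearMap R.tensorVal_injective).symm.toLinearMap ∘ₗ
    ((Coalgebra.comul (R := k) (A := H)) ∘ₗ R.toSubalgebra.val.toLinearMap).codRestrict
      (LinearMap.range R.tensorVal.toLinearMap) (fun r => R.comul_mem' r r.2)

theorem tensorVal_comulRestrict (R : HopfSubalgebra k H) (r : R.toSubalgebra) :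
    R.tensorVal (R.comulRestrict r) = Coalgebra.comul (R := k) (r : H) := by
  have := LinearEquiv.ofInjective_symm_apply (f := R.tensorVal.toLinearMap)
    (h := R.tensorVal_injective) ⟨Coalgebra.comul (R := k) (r : H), R.comul_mem' r r.2⟩
  exact this

/-- The antipode of `R`, the restriction of that of `H`. -/
noncomputable def antipodeRestrict (R : HopfSubalgebra k H) :
    R.toSubalgebra →ₗ[k] R.toSubalgebra :=
  (HopfAlgebra.antipode k (A := H) ∘ₗ R.toSubalgebra.val.toLinearMap).codRestrict
    (Subalgebra.toSubmodule R.toSubalgebra) (fun r => R.antipode_mem' r r.2)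

theorem map_comp_comulRestrict (R : HopfSubalgebra k H) :
    TensorProduct.map R.toSubalgebra.val.toLinearMap R.toSubalgebra.val.toLinearMap ∘ₗ
      R.comulRestrict = Coalgebra.comul ∘ₗ R.toSubalgebra.val.toLinearMap :=
  LinearMap.ext R.tensorVal_comulRestrict

noncomputable instance instCoalgebra (R : HopfSubalgebra k H) :
    Coalgebra k R.toSubalgebra where
  comul := R.comulRestrict
  counit := Coalgebra.counit ∘ₗ R.toSubalgebra.val.toLinearMap
  coassoc := by
    set i := R.toSubalgebra.val.toLinearMap with hi
    have hinj : Function.Injective (TensorProduct.map i (TensorProduct.map i i)) :=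
      TensorProduct.map_injective_of_flat_flat _ _ Subtype.val_injective R.tensorVal_injective
    have hc : TensorProduct.map i i ∘ₗ R.comulRestrict = Coalgebra.comul ∘ₗ i :=
      R.map_comp_comulRestrict
    have hL : ∀ x, TensorProduct.map (TensorProduct.map i i) i
        (R.comulRestrict.rTensor _ x) = (Coalgebra.comul (R := k)).rTensor H
          (TensorProduct.map i i x) := by
      intro x
      rw [LinearMap.rTensor, LinearMap.rTensor, ← LinearMap.comp_apply, ← LinearMap.comp_apply,
        ← TensorProduct.map_comp, ← TensorProduct.map_comp, hc]
      rfl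
    have hR : ∀ x, TensorProduct.map i (TensorProduct.map i i)
        (R.comulRestrict.lTensor _ x) = (Coalgebra.comul (R := k)).lTensor H
          (TensorProduct.map i i x) := by
      intro x
      rw [LinearMap.lTensor, LinearMap.lTensor, ← LinearMap.comp_apply, ← LinearMap.comp_apply,
        ← TensorProduct.map_comp, ← TensorProduct.map_comp, hc]
      rfl
    have hA : ∀ x, TensorProduct.map i (TensorProduct.map i i) (TensorProduct.assoc k _ _ _ x) =
        TensorProduct.assoc k _ _ _ (TensorProduct.map (TensorProduct.map i i) i x) := by
      intro x
      exact LinearMap.congr_fun (TensorProduct.map_map_comp_assoc_eq i i i) x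
    ext r
    apply hinj
    have hr : TensorProduct.map i i (R.comulRestrict r) = Coalgebra.comul (R := k) (r : H) :=
      R.tensorVal_comulRestrict r
    simp only [LinearMap.comp_apply, LinearEquiv.coe_coe]
    rw [hA, hL, hR, hr, Coalgebra.coassoc_apply]
  rTensor_counit_comp_comul := by
    ext r
    set i := R.toSubalgebra.val.toLinearMap with hi
    have hinj : Function.Injective (i.lTensor k) :=
      Module.Flat.lTensor_preserves_injective_linearMap i Subtype.val_injective
    have hr : TensorProduct.map i i (R.comulRestrict r) = Coalgebra.comul (R := k) (r : H) :=
      R.tensorVal_comulRestrict r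
    have h : ∀ x, i.lTensor k ((Coalgebra.counit ∘ₗ i).rTensor _ x) =
        (Coalgebra.counit (R := k)).rTensor H (TensorProduct.map i i x) := by
      intro x
      rw [LinearMap.lTensor, LinearMap.rTensor, LinearMap.rTensor, ← LinearMap.comp_apply,
        ← LinearMap.comp_apply, ← TensorProduct.map_comp, ← TensorProduct.map_comp]
      rfl
    apply hinj
    rw [LinearMap.comp_apply, h, hr, Coalgebra.rTensor_counit_comul]
    rfl
  lTensor_counit_comp_comul := by
    ext r
    set i := R.toSubalgebra.val.toLinearMap with hi
    have hinj : Function.Injective (i.rTensor k) :=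
      Module.Flat.rTensor_preserves_injective_linearMap i Subtype.val_injective
    have hr : TensorProduct.map i i (R.comulRestrict r) = Coalgebra.comul (R := k) (r : H) :=
      R.tensorVal_comulRestrict r
    have h : ∀ x, i.rTensor k ((Coalgebra.counit ∘ₗ i).lTensor _ x) =
        (Coalgebra.counit (R := k)).lTensor H (TensorProduct.map i i x) := by
      intro x
      rw [LinearMap.lTensor, LinearMap.rTensor, LinearMap.lTensor, ← LinearMap.comp_apply,
        ← LinearMap.comp_apply, ← TensorProduct.map_comp, ← TensorProduct.map_comp]
      rfl
    apply hinj
    rw [LinearMap.comp_apply, h, hr, Coalgebra.lTensor_counit_comul]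
    rfl

theorem counit_def (R : HopfSubalgebra k H) (r : R.toSubalgebra) :
    Coalgebra.counit (R := k) r = Coalgebra.counit (R := k) (r : H) := rfl

theorem tensorVal_comul (R : HopfSubalgebra k H) (r : R.toSubalgebra) :
    R.tensorVal (Coalgebra.comul (R := k) r) = Coalgebra.comul (R := k) (r : H) :=
  R.tensorVal_comulRestrict r

noncomputable instance instBialgebra (R : HopfSubalgebra k H) :
    Bialgebra k R.toSubalgebra :=
  Bialgebra.mk' k R.toSubalgebra
    (by rw [counit_def]; exact Bialgebra.counit_one)
    (by intro a b; simp only [counit_def]; exact Bialgebra.counit_mul _ _)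
    (by
      apply R.tensorVal_injective
      rw [tensorVal_comul, map_one]; exact Bialgebra.comul_one)
    (by
      intro a b
      apply R.tensorVal_injective
      rw [map_mul R.tensorVal, tensorVal_comul, tensorVal_comul, tensorVal_comul]
      exact Bialgebra.comul_mul _ _)

/-- A Hopf subalgebra is a Hopf algebra, by restriction of the structure maps. -/
noncomputable instance instHopfAlgebra (R : HopfSubalgebra k H) :
    HopfAlgebra k R.toSubalgebra where
  antipode := R.antipodeRestrict
  mul_antipode_rTensor_comul := by
    ext r
    have h : ∀ x, ((LinearMap.mul' k _ (R.antipodeRestrict.rTensor _ x) : R.toSubalgebra) : H) =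
        LinearMap.mul' k H ((HopfAlgebra.antipode k).rTensor H (R.tensorVal x)) := by
      intro x
      induction x with
      | zero => simp
      | tmul a b => rfl
      | add a b ha hb => simp only [map_add, ← ha, ← hb]; rfl
    simp only [LinearMap.comp_apply]
    rw [h, tensorVal_comul, HopfAlgebra.mul_antipode_rTensor_comul_apply]
    rfl
  mul_antipode_lTensor_comul := by
    ext r
    have h : ∀ x, ((LinearMap.mul' k _ (R.antipodeRestrict.lTensor _ x) : R.toSubalgebra) : H) =
        LinearMap.mul' k H ((HopfAlgebra.antipode k).lTensor H (R.tensorVal x)) := by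
      intro x
      induction x with
      | zero => simp
      | tmul a b => rfl
      | add a b ha hb => simp only [map_add, ← ha, ← hb]; rfl
    simp only [LinearMap.comp_apply]
    rw [h, tensorVal_comul, HopfAlgebra.mul_antipode_lTensor_comul_apply]
    rfl

/-- `R⁺H`, the right ideal of `H` generated by the elements of `R` with counit zero
(right ideals of `H` are the `Hᵐᵒᵖ`-submodules of `H`). -/
def augmentationRightIdeal (R : HopfSubalgebra k H) : Submodule Hᵐᵒᵖ H :=
  Submodule.span Hᵐᵒᵖ {h : H | h ∈ R.toSubalgebra ∧ Coalgebra.counit (R := k) h = 0}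

/-- The right `H`-module `Q = H / R⁺H`. -/
abbrev Quot (R : HopfSubalgebra k H) : Type _ := H ⧸ R.augmentationRightIdeal

/-- `t ∈ Q` is a right `H/R`-integral: `t h = t ε(h)` for every `h ∈ H`. -/
def IsRightRelativeIntegral (R : HopfSubalgebra k H) (t : R.Quot) : Prop :=
  ∀ h : H, op h • t = Coalgebra.counit (R := k) h • t

end HopfSubalgebra

/-- `t` is a right integral in the Hopf algebra `A`: `t a = t ε(a)` for every `a ∈ A`. -/
def IsRightIntegral (k : Type*) {A : Type*} [Field k] [Ring A] [HopfAlgebra k A] (t : A) : Prop :=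
  ∀ a : A, t * a = Coalgebra.counit (R := k) a • t

/-- `m` is the right modular function of `A`: `a t = m(a) t` for all `a ∈ A` and all right
integrals `t` in `A`. -/
def IsRightModularFunction (k : Type*) {A : Type*} [Field k] [Ring A] [HopfAlgebra k A]
    (m : A → k) : Prop :=
  ∀ t : A, IsRightIntegral k t → ∀ a : A, a * t = m a • t

/-- The ring extension `f : B → A` is an (ordinary) Frobenius extension: there are a
`B`-`B`-bimodule map `E : A → B` (a Frobenius homomorphism) and finite families `x`, `y` in `A`
(dual bases) with `∑ xᵢ E(yᵢ a) = a = ∑ E(a xᵢ) yᵢ` for all `a ∈ A`. -/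
def IsFrobeniusExtension {B A : Type*} [Ring B] [Ring A] (f : B →+* A) : Prop :=
  ∃ E : A →+ B,
    (∀ (b : B) (a : A), E (f b * a) = b * E a) ∧
    (∀ (a : A) (b : B), E (a * f b) = E a * b) ∧
    ∃ (n : ℕ) (x y : Fin n → A), ∀ a : A,
      ∑ i, x i * f (E (y i * a)) = a ∧ ∑ i, f (E (a * x i)) * y i = a

/-! The heart of the matter is that `H` is projective as a left `R`-module
(`exists_projective_basis`). Let `t` be a nonzero right integral of `R`. Reading coordinates in a
projective basis shows that `t h = 0` exactly when `h ∈ R⁺H`, so `x ↦ t x` identifies `Q` with `tH`,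
and relative integrals with the right integrals of `H` lying in `tH`. It also shows that `tH` is the
set of `x` with `r x = m_R(r) x` for all `r`. Hence 1 holds iff the right integrals of `H` lie in
`tH`, iff 3 holds.

3 ⇒ 2: `H` and `R` carry Frobenius forms with `l(x a) = l(ν(a) x)`, where `ν` depends only on `S²`
and the modular function (`IsLeftIntegral.exists_frobeniusForm`). Under 3 the two maps `ν` agree on
`R`, so the left `R`-linear `E` with `l_R ∘ E = l_H` is also right `R`-linear, and a projective
basis yields dual bases. 2 ⇒ 1: `∑ ε(xᵢ) yᵢ` represents a nonzero relative integral.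

Projectivity comes from a dimension count. For a left integral `t ≠ 0` of `R`, let the defect `d(V)`
of an `R`-module be the dimension of its invariants modulo `tV`; it vanishes on free modules. Now `V
⊗ H ⊗ H` is `dim H` copies of `V ⊗ H`, while `H = R ⊕ K` over `R` and `V ⊗ R ⊗ H` is free, so `dim H
· d(V ⊗ H) ≤ d(V ⊗ K ⊗ H)`. Iterating, `(dim H)^m d(V ⊗ H) ≤ (dim K)^m dim V dim H`, and `dim K <
dim H` forces `d(V ⊗ H) = 0`. Applied to the coproduct of an integral of `H`, this gives an
`R`-linear `φ : H → R` with `ε ∘ φ = ε`; then `(φ ⊗ id)Δ` makes `H` a summand of the free module `R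
⊗ H`. -/

open Coalgebra HopfAlgebra TensorProduct Module

namespace HopfRep

/-! ### Diagonal actions and how to untwist them -/

section Twist

variable {k A V W : Type*} [Field k] [Ring A] [HopfAlgebra k A]
  [AddCommGroup V] [Module k V] [AddCommGroup W] [Module k W]

/-- The diagonal action of a bialgebra on the tensor product of two representations. -/
noncomputable def tensorRep (ρ : A →ₐ[k] End k V) (σ : A →ₐ[k] End k W) :
    A →ₐ[k] End k (V ⊗[k] W) :=
  (endTensorEndAlgHom (R := k) (S := k) (A := k)).comp
    ((Algebra.TensorProduct.map ρ σ).comp (Bialgebra.comulAlgHom k A))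

theorem tensorRep_apply (ρ : A →ₐ[k] End k V) (σ : A →ₐ[k] End k W) {a : A} {ι : Type*}
    (r : Coalgebra.Repr k a ι) :
    tensorRep ρ σ a = ∑ i ∈ r.index, TensorProduct.map (ρ (r.left i)) (σ (r.right i)) := by
  simp only [tensorRep, AlgHom.comp_apply, Bialgebra.comulAlgHom_apply, ← r.eq, map_sum,
    Algebra.TensorProduct.map_tmul]
  rfl

theorem tensorRep_tmul (ρ : A →ₐ[k] End k V) (σ : A →ₐ[k] End k W) {a : A} {ι : Type*}
    (r : Coalgebra.Repr k a ι) (v : V) (w : W) :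
    tensorRep ρ σ a (v ⊗ₜ w) = ∑ i ∈ r.index, ρ (r.left i) v ⊗ₜ[k] σ (r.right i) w := by
  simp [tensorRep_apply ρ σ r]

/-- The map `a ⊗ w ↦ a₁ ⊗ f(a₂) w`. -/
noncomputable def twistLeft (f : A →ₗ[k] End k W) : A ⊗[k] W →ₗ[k] A ⊗[k] W :=
  (TensorProduct.lift f).lTensor A ∘ₗ (TensorProduct.assoc k A A W).toLinearMap ∘ₗ
    (comul (R := k)).rTensor W

theorem twistLeft_tmul (f : A →ₗ[k] End k W) {a : A} {ι : Type*} (r : Coalgebra.Repr k a ι)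
    (w : W) : twistLeft f (a ⊗ₜ w) = ∑ i ∈ r.index, r.left i ⊗ₜ[k] f (r.right i) w := by
  simp [twistLeft, ← r.eq, TensorProduct.sum_tmul]

/-- The map `w ⊗ a ↦ f(a₁) w ⊗ a₂`. -/
noncomputable def twistRight (f : A →ₗ[k] End k W) : W ⊗[k] A →ₗ[k] W ⊗[k] A :=
  ((TensorProduct.lift f).rTensor A ∘ₗ (TensorProduct.comm k W (A)).toLinearMap.rTensor A ∘ₗ
    (TensorProduct.assoc k W A A).symm.toLinearMap) ∘ₗ (comul (R := k)).lTensor W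

theorem twistRight_tmul (f : A →ₗ[k] End k W) {a : A} {ι : Type*} (r : Coalgebra.Repr k a ι)
    (w : W) : twistRight f (w ⊗ₜ a) = ∑ i ∈ r.index, f (r.left i) w ⊗ₜ[k] r.right i := by
  simp [twistRight, ← r.eq, TensorProduct.tmul_sum]

/-- By coassociativity the composite is `a ⊗ w ↦ a₁ ⊗ f(a₂) g(a₃) w`, so twists compose by
convolution. -/
theorem twistLeft_twistLeft {f g : A →ₗ[k] End k W}
    (h : ∀ a : A, ∑ i ∈ (ℛ k a).index, f ((ℛ k a).left i) * g ((ℛ k a).right i) =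
      algebraMap k _ (counit a)) (x : A ⊗[k] W) : twistLeft f (twistLeft g x) = x := by
  induction x with
  | zero => simp
  | add x y hx hy => simp [hx, hy]
  | tmul a w =>
    have key := congrArg (((LinearMap.applyₗ w) ∘ₗ LinearMap.mul' k (End k W) ∘ₗ
      TensorProduct.map f g).lTensor A)
      (sum_tmul_tmul_eq (ℛ k a) (fun i => ℛ k _) (fun i => ℛ k _))
    simp only [map_sum, LinearMap.lTensor_tmul, LinearMap.comp_apply, TensorProduct.map_tmul,
      LinearMap.mul'_apply, LinearMap.applyₗ_apply_apply] at key
    rw [twistLeft_tmul g (ℛ k a), map_sum]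
    simp only [fun i => twistLeft_tmul f (ℛ k ((ℛ k a).left i))]
    refine key.trans ?_
    simp only [← TensorProduct.tmul_sum, ← LinearMap.sum_apply, h]
    simp only [algebraMap_end_apply, TensorProduct.tmul_smul, TensorProduct.smul_tmul',
      ← TensorProduct.sum_tmul]
    have := sum_tmul_counit_eq (ℛ k a)
    have h2 := congrArg (TensorProduct.rid k A) this
    simp only [map_sum, TensorProduct.rid_tmul, one_smul] at h2
    rw [h2]

/-- Here the composite is `f(a₂) g(a₁) w ⊗ a₃`: the order is reversed, so inverting such a twist
takes `S⁻¹` in place of `S`. -/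
theorem twistRight_twistRight {f g : A →ₗ[k] End k W}
    (h : ∀ a : A, ∑ i ∈ (ℛ k a).index, f ((ℛ k a).right i) * g ((ℛ k a).left i) =
      algebraMap k _ (counit a)) (x : W ⊗[k] A) : twistRight f (twistRight g x) = x := by
  induction x with
  | zero => simp
  | add x y hx hy => simp [hx, hy]
  | tmul w a =>
    have key := congrArg (((LinearMap.applyₗ w) ∘ₗ LinearMap.mul' k (End k W) ∘ₗ
      TensorProduct.map f g ∘ₗ (TensorProduct.comm k A A).toLinearMap).rTensor A ∘ₗ
      (TensorProduct.assoc k A A A).symm.toLinearMap)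
      (sum_tmul_tmul_eq (ℛ k a) (fun i => ℛ k _) (fun i => ℛ k _))
    simp only [map_sum, LinearMap.rTensor_tmul, LinearMap.comp_apply, TensorProduct.map_tmul,
      LinearMap.mul'_apply, LinearMap.applyₗ_apply_apply, LinearEquiv.coe_coe,
      TensorProduct.assoc_symm_tmul, TensorProduct.comm_tmul] at key
    rw [twistRight_tmul g (ℛ k a), map_sum]
    simp only [fun i => twistRight_tmul f (ℛ k ((ℛ k a).right i))]
    refine key.symm.trans ?_
    simp only [← TensorProduct.sum_tmul, ← LinearMap.sum_apply, h]
    simp only [algebraMap_end_apply, TensorProduct.smul_tmul, ← TensorProduct.tmul_sum]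
    rw [sum_counit_smul]

/-- The isomorphism `a ⊗ w ↦ a₁ ⊗ a₂ w` from `A ⊗ W`, with `A` acting on the first factor, to
`A ⊗ W` with the diagonal action. -/
noncomputable def galoisEquiv (ρ : A →ₐ[k] End k W) : A ⊗[k] W ≃ₗ[k] A ⊗[k] W :=
  LinearEquiv.ofLinearMap (twistLeft ρ.toLinearMap) (twistLeft (ρ.toLinearMap ∘ₗ antipode k))
    (LinearMap.ext fun x => twistLeft_twistLeft (fun a => by
      simpa using congrArg ρ (sum_mul_antipode_eq_algebraMap_counit (ℛ k a))) x)
    (LinearMap.ext fun x => twistLeft_twistLeft (fun a => by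
      simpa using congrArg ρ (sum_antipode_mul_eq_algebraMap_counit (ℛ k a))) x)

theorem galoisEquiv_tmul (ρ : A →ₐ[k] End k W) (a : A) (w : W) :
    galoisEquiv ρ (a ⊗ₜ w) = tensorRep (Algebra.lmul k A) ρ a (1 ⊗ₜ w) := by
  rw [tensorRep_tmul _ _ (ℛ k a)]
  exact (twistLeft_tmul _ (ℛ k a) w).trans (by simp)

theorem galoisEquiv_map_mul (ρ : A →ₐ[k] End k W) (a : A) (x : A ⊗[k] W) :
    galoisEquiv ρ ((Algebra.lmul k A a).rTensor W x) =
      tensorRep (Algebra.lmul k A) ρ a (galoisEquiv ρ x) := by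
  induction x with
  | zero => simp
  | add x y hx hy => simp only [map_add, hx, hy]
  | tmul b w =>
    rw [galoisEquiv_tmul, LinearMap.rTensor_tmul]
    exact (galoisEquiv_tmul ρ (a * b) w).trans (by rw [map_mul]; rfl)

theorem twistRight_surjective (ρ : A →ₐ[k] End k W)
    (hS : Function.Bijective (antipode k (A := A))) :
    Function.Surjective (twistRight ρ.toLinearMap) := by
  let e := LinearEquiv.ofBijective _ hS
  intro x
  refine ⟨twistRight (ρ.toLinearMap ∘ₗ e.symm.toLinearMap) x, twistRight_twistRight (fun a => ?_) x⟩
  have h : ∑ i ∈ (ℛ k a).index, (ℛ k a).right i * e.symm ((ℛ k a).left i) =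
      algebraMap k A (counit a) := by
    apply hS.1
    have h1 : ∀ b, antipode k (e.symm b) = b := e.apply_symm_apply
    simp only [map_sum, antipode_mul_antidistrib, h1, sum_mul_antipode_eq_algebraMap_counit]
    rw [Algebra.algebraMap_eq_smul_one, map_smul, antipode_one]
  simpa using congrArg ρ h

end Twist

end HopfRep

namespace HopfRep

/-! ### Existence of integrals and bijectivity of the antipode -/

section Integral

variable (k : Type*) {A : Type*} [Field k] [Ring A] [HopfAlgebra k A]

/-- `t` is a left integral: `a t = ε(a) t` for all `a`. -/
def IsLeftIntegral (t : A) : Prop := ∀ a : A, a * t = counit (R := k) a • t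

/-- The action `(a f)(x) = f(x a)` on the dual. -/
noncomputable def dualRep : A →ₐ[k] End k (Dual k A) :=
  AlgHom.ofLinearMap (LinearMap.mk₂ k (fun (a : A) (f : Dual k A) => f ∘ₗ LinearMap.mulRight k a)
    (fun a b f => by ext; simp [mul_add]) (fun c a f => by ext; simp)
    (fun a f g => by ext; simp) (fun c a f => by ext; simp))
    (by ext; simp) (fun a b => by ext f x; simp [mul_assoc])

theorem dualRep_apply (a : A) (f : Dual k A) (x : A) : dualRep k a f x = f (x * a) := rfl

/-- On `A ⊗ A* ≅ End A` the diagonal action is `(a T)(b) = ∑ a₁ T(b a₂)`. It fixes the antipode,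
because `a₁ S(b a₂) = a₁ S(a₂) S(b) = ε(a) S(b)`. Untwisting turns `S` into a nonzero invariant for
multiplication on the first factor alone, whose coordinates are left integrals. -/
theorem exists_isLeftIntegral [FiniteDimensional k A] : ∃ t : A, t ≠ 0 ∧ IsLeftIntegral k t := by
  let e : A ⊗[k] Dual k A ≃ₗ[k] (A →ₗ[k] A) :=
    TensorProduct.comm k A (Dual k A) ≪≫ₗ dualTensorHomEquiv k A A
  have he : ∀ (a : A) (f : Dual k A) (b : A), e (a ⊗ₜ f) b = f b • a := fun a f b => by simp [e]
  have hdiag : ∀ (a : A) (z : A ⊗[k] Dual k A) (b : A),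
      e (tensorRep (Algebra.lmul k A) (dualRep k) a z) b =
        ∑ i ∈ (ℛ k a).index, (ℛ k a).left i * e z (b * (ℛ k a).right i) := by
    intro a z b
    induction z with
    | zero => simp
    | add x y hx hy => simp only [map_add, LinearMap.add_apply, hx, hy, mul_add,
        Finset.sum_add_distrib]
    | tmul x f =>
      rw [tensorRep_tmul _ _ (ℛ k a)]
      simp only [map_sum, LinearMap.sum_apply, he, dualRep_apply]
      simp
  set c := e.symm (antipode k) with hc
  have hcinv : ∀ a : A, tensorRep (Algebra.lmul k A) (dualRep k) a c = counit (R := k) a • c := by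
    intro a
    apply e.injective
    ext b
    rw [hdiag, hc]
    simp only [LinearEquiv.apply_symm_apply, antipode_mul_antidistrib, map_smul,
      LinearMap.smul_apply, ← mul_assoc, ← Finset.sum_mul]
    rw [sum_mul_antipode_eq_algebraMap_counit, ← Algebra.smul_def]
  set d := (galoisEquiv (dualRep k)).symm c with hd
  have hdinv : ∀ a : A, (Algebra.lmul k A a).rTensor _ d = counit (R := k) a • d := by
    intro a
    apply (galoisEquiv (dualRep k)).injective
    rw [galoisEquiv_map_mul, hd, map_smul, LinearEquiv.apply_symm_apply, hcinv]
  have hne : d ≠ 0 := by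
    intro h0
    have h1 : c = 0 := by
      rw [hd] at h0
      simpa using h0
    have h2 : antipode k (A := A) = 0 := by simpa [hc] using h1
    have h3 : (1 : A) = 0 := by rw [← antipode_one (R := k), h2, LinearMap.zero_apply]
    have h4 : (1 : k) = 0 := by
      rw [← Bialgebra.counit_one (R := k) (A := A), h3, map_zero]
    exact one_ne_zero h4
  classical
  let b := Basis.ofVectorSpace k (Dual k A)
  let E := TensorProduct.equivFinsuppOfBasisRight (M := A) b
  have hE : E d ≠ 0 := by simpa using hne
  obtain ⟨i, hi⟩ := Finsupp.ne_iff.1 hE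
  refine ⟨E d i, hi, fun a => ?_⟩
  have hEmul : ∀ z, E ((Algebra.lmul k A a).rTensor _ z) i = a * E z i := by
    intro z
    induction z with
    | zero => simp
    | add x y hx hy => simp only [map_add, Finsupp.add_apply, hx, hy, mul_add]
    | tmul x f =>
      simp only [LinearMap.rTensor_tmul, E,
        TensorProduct.equivFinsuppOfBasisRight_apply_tmul_apply]
      simp
  rw [← hEmul, hdinv]
  simp

theorem sum_smul_counit {a : A} {ι : Type*} (r : Coalgebra.Repr k a ι) :
    ∑ i ∈ r.index, counit (R := k) (r.right i) • r.left i = a := by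
  simpa only [map_sum, TensorProduct.rid_tmul, one_smul] using
    congrArg (TensorProduct.rid k A) (sum_tmul_counit_eq r)

theorem antipode_left_comul_mul (a : A) :
    ∑ i ∈ (ℛ k a).index, (antipode k ((ℛ k a).left i) ⊗ₜ[k] (1 : A)) * comul ((ℛ k a).right i) =
      1 ⊗ₜ[k] a := by
  have key := congrArg ((LinearMap.mul' k A ∘ₗ (antipode k).rTensor A).rTensor A ∘ₗ
      (TensorProduct.assoc k A A A).symm.toLinearMap)
      (sum_tmul_tmul_eq (ℛ k a) (fun i => ℛ k _) (fun i => ℛ k _))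
  simp only [map_sum, LinearMap.rTensor_tmul, LinearMap.comp_apply, LinearEquiv.coe_coe,
      TensorProduct.assoc_symm_tmul, LinearMap.mul'_apply] at key
  simp only [← TensorProduct.sum_tmul, sum_antipode_mul_eq_algebraMap_counit] at key
  simp only [← (ℛ k _).eq, Finset.mul_sum, Algebra.TensorProduct.tmul_mul_tmul, one_mul]
  rw [← key]
  simp only [Algebra.algebraMap_eq_smul_one, TensorProduct.smul_tmul, ← TensorProduct.tmul_sum,
    sum_counit_smul]

theorem comul_mul_antipode_right {a : A} {ι : Type*} (r : Coalgebra.Repr k a ι) :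
    ∑ i ∈ r.index, comul (r.left i) * ((1 : A) ⊗ₜ[k] antipode k (r.right i)) = a ⊗ₜ[k] 1 := by
  have key := congrArg ((LinearMap.mul' k A ∘ₗ (antipode k).lTensor A).lTensor A)
      (sum_tmul_tmul_eq r (fun i => ℛ k _) (fun i => ℛ k _))
  simp only [map_sum, LinearMap.lTensor_tmul, LinearMap.comp_apply,
    LinearMap.mul'_apply] at key
  simp only [← TensorProduct.tmul_sum, sum_mul_antipode_eq_algebraMap_counit] at key
  simp only [← (ℛ k _).eq, Finset.sum_mul, Algebra.TensorProduct.tmul_mul_tmul, mul_one]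
  rw [key]
  simp only [Algebra.algebraMap_eq_smul_one, ← TensorProduct.smul_tmul, ← TensorProduct.sum_tmul,
    sum_smul_counit]

variable {k}

/-- Expand `1 ⊗ a = ∑ (S(a₁) ⊗ 1) Δ(a₂)` and absorb `Δ(a₂)` into `Δ(t)`. -/
theorem IsLeftIntegral.one_tmul_mul_comul {t : A} (ht : IsLeftIntegral k t) (a : A) :
    (1 ⊗ₜ[k] a) * comul t = (antipode k a ⊗ₜ[k] (1 : A)) * comul t := by
  rw [← antipode_left_comul_mul, Finset.sum_mul]
  simp only [mul_assoc, ← Bialgebra.comul_mul, ht _, map_smul]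
  simp only [mul_smul_comm, ← smul_mul_assoc, ← Finset.sum_mul]
  simp only [TensorProduct.smul_tmul', ← TensorProduct.sum_tmul, ← map_smul, ← map_sum,
    sum_smul_counit]

theorem comul_mul_tmul_one {t : A} {α : A → k} (ht : ∀ a, t * a = α a • t) {a : A} {ι : Type*}
    (r : Coalgebra.Repr k a ι) :
    comul t * (a ⊗ₜ[k] 1) = ∑ i ∈ r.index, α (r.left i) •
      (comul t * ((1 : A) ⊗ₜ[k] antipode k (r.right i))) := by
  rw [← comul_mul_antipode_right k r, Finset.mul_sum]
  simp only [← mul_assoc, ← Bialgebra.comul_mul, ht _, map_smul, smul_mul_assoc]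

variable (k) in
/-- The map `f ↦ f(t₁) t₂`. -/
noncomputable def contract (t : A) : Dual k A →ₗ[k] A :=
  (TensorProduct.lid k A).toLinearMap ∘ₗ LinearMap.applyₗ (comul t) ∘ₗ LinearMap.rTensorHom A

theorem contract_apply (t : A) (f : Dual k A) :
    contract k t f = TensorProduct.lid k A (f.rTensor A (comul t)) := rfl

theorem contract_eq_sum {t : A} {ι : Type*} (r : Coalgebra.Repr k t ι) (f : Dual k A) :
    contract k t f = ∑ i ∈ r.index, f (r.left i) • r.right i := by
  simp [contract_apply, ← r.eq]

theorem lid_rTensor_mul (f : Dual k A) (a b : A) (z : A ⊗[k] A) :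
    TensorProduct.lid k A (f.rTensor A ((a ⊗ₜ b) * z)) =
      b * TensorProduct.lid k A ((f ∘ₗ LinearMap.mulLeft k a).rTensor A z) := by
  induction z with
  | zero => simp
  | add x y hx hy => simp only [mul_add, map_add, hx, hy]
  | tmul x y => simp

theorem lid_rTensor_mul_right (f : Dual k A) (a b : A) (z : A ⊗[k] A) :
    TensorProduct.lid k A (f.rTensor A (z * (a ⊗ₜ b))) =
      TensorProduct.lid k A ((f ∘ₗ LinearMap.mulRight k a).rTensor A z) * b := by
  induction z with
  | zero => simp
  | add x y hx hy => simp only [add_mul, map_add, hx, hy]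
  | tmul x y => simp

theorem IsLeftIntegral.mul_contract {t : A} (ht : IsLeftIntegral k t) (a : A) (f : Dual k A) :
    a * contract k t f = contract k t (f ∘ₗ LinearMap.mulLeft k (antipode k a)) := by
  have h := congrArg (fun z => TensorProduct.lid k A (f.rTensor A z)) (ht.one_tmul_mul_comul a)
  simp only [lid_rTensor_mul, one_mul] at h
  simpa [contract_apply, LinearMap.mulLeft_one] using h

/-- The image of `S ∘ contract` is a right ideal. The argument does not invert `S`, since
bijectivity of `S` is deduced from it. -/
theorem IsLeftIntegral.antipode_contract_mul {t : A} (ht : IsLeftIntegral k t) (b : A)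
    (f : Dual k A) : antipode k (contract k t f) * b =
      antipode k (contract k t (f ∘ₗ LinearMap.mulLeft k b)) := by
  -- For `z = x ⊗ y` this is `f(b₁ x) S(y) S(b₂) b₃ = f(b x) S(y)`. At `z = Δ(t)` the factor `Δ(b₁)`
  -- is absorbed as `ε(b₁)`.
  have hz : ∀ z : A ⊗[k] A, ∑ i ∈ (ℛ k b).index,
      antipode k (TensorProduct.lid k A (f.rTensor A (comul ((ℛ k b).left i) * z))) *
        (ℛ k b).right i =
      antipode k (TensorProduct.lid k A ((f ∘ₗ LinearMap.mulLeft k b).rTensor A z)) := by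
    intro z
    induction z with
    | zero => simp
    | add x y hx hy =>
      simp only [mul_add, map_add, add_mul, Finset.sum_add_distrib, hx, hy]
    | tmul x y =>
      have key := congrArg (TensorProduct.lid k A ∘
        (TensorProduct.map (f ∘ₗ LinearMap.mulRight k x)
          (LinearMap.mulLeft k (antipode k y) ∘ₗ LinearMap.mul' k A ∘ₗ (antipode k).rTensor A)))
        (sum_tmul_tmul_eq (ℛ k b) (fun i => ℛ k _) (fun i => ℛ k _))
      simp only [Function.comp_apply, map_sum, TensorProduct.map_tmul, LinearMap.comp_apply,
        LinearMap.rTensor_tmul, LinearMap.mul'_apply, TensorProduct.lid_tmul,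
        LinearMap.mulLeft_apply, LinearMap.mulRight_apply] at key
      simp only [← (ℛ k _).eq, Finset.sum_mul, Algebra.TensorProduct.tmul_mul_tmul, map_sum,
        LinearMap.rTensor_tmul, TensorProduct.lid_tmul, map_smul, antipode_mul_antidistrib,
        smul_mul_assoc, mul_assoc, LinearMap.comp_apply, LinearMap.mulLeft_apply]
      rw [key]
      simp only [← Finset.smul_sum, ← Finset.mul_sum, sum_antipode_mul_eq_smul, mul_smul_comm,
        mul_one, smul_smul]
      rw [← Finset.sum_smul]
      congr 1
      have h := congrArg (fun z => f (z * x)) (sum_smul_counit k (ℛ k b))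
      simp only [Finset.sum_mul, map_sum, smul_mul_assoc, map_smul, smul_eq_mul] at h
      simpa only [mul_comm (f _), LinearMap.comp_apply, LinearMap.mulLeft_apply] using h
  rw [contract_apply t (f ∘ₗ _), ← hz]
  simp only [← Bialgebra.comul_mul, ht _, map_smul, smul_mul_assoc]
  simp only [← mul_smul_comm, ← Finset.mul_sum, sum_counit_smul]
  rfl

variable [FiniteDimensional k A]

/-- This is `f(t₁) S(t₂) t₃ = f(t) 1` with `t₂` expanded in a basis, which exhibits a multiple of
`1` through contractions. -/
theorem sum_antipode_mul_contract (t : A) (f : Dual k A) :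
    ∑ j, antipode k (Module.finBasis k A j) * contract k t (LinearMap.mul' k k ∘ₗ
      TensorProduct.map f ((Module.finBasis k A).coord j) ∘ₗ comul) = f t • 1 := by
  have key := congrArg (TensorProduct.lid k A ∘ TensorProduct.map f
    (LinearMap.mul' k A ∘ₗ (antipode k).rTensor A))
    (sum_tmul_tmul_eq (ℛ k t) (fun i => ℛ k _) (fun i => ℛ k _))
  simp only [Function.comp_apply, map_sum, TensorProduct.map_tmul, LinearMap.comp_apply,
    LinearMap.rTensor_tmul, LinearMap.mul'_apply, TensorProduct.lid_tmul] at key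
  simp only [contract_eq_sum (ℛ k t), Finset.mul_sum]
  rw [Finset.sum_comm]
  have h1 : ∀ x y : A, ∑ j, antipode k (Module.finBasis k A j) * ((LinearMap.mul' k k ∘ₗ
      TensorProduct.map f ((Module.finBasis k A).coord j) ∘ₗ comul) x • y) =
      ∑ i ∈ (ℛ k x).index, f ((ℛ k x).left i) • (antipode k ((ℛ k x).right i) * y) := by
    intro x y
    simp only [LinearMap.comp_apply, ← (ℛ k x).eq, map_sum, TensorProduct.map_tmul,
      LinearMap.mul'_apply, Finset.sum_smul, Finset.mul_sum]
    rw [Finset.sum_comm]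
    refine Finset.sum_congr rfl fun i _ => ?_
    conv_rhs => rw [← (Module.finBasis k A).sum_repr ((ℛ k x).right i)]
    simp only [map_sum, map_smul, Finset.sum_mul, Finset.smul_sum, smul_mul_assoc, smul_smul,
      mul_smul_comm, Basis.coord_apply]
  simp only [h1]
  rw [key]
  simp only [← Finset.smul_sum, sum_antipode_mul_eq_smul, smul_smul]
  rw [← Finset.sum_smul]
  congr 1
  simp only [mul_comm _ (counit _), ← smul_eq_mul, ← map_smul, ← map_sum, sum_smul_counit]

/-- Applying `S` to the previous identity, with `f(t) ≠ 0`, puts `1` in the right ideal formed by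
the image of `S ∘ contract`. -/
theorem IsLeftIntegral.antipode_contract_surjective {t : A} (ht : IsLeftIntegral k t)
    (h0 : t ≠ 0) (a : A) : ∃ f, antipode k (contract k t f) = a := by
  obtain ⟨f, hf⟩ : ∃ f : Dual k A, f t ≠ 0 := by
    by_contra! h
    exact h0 ((Module.forall_dual_apply_eq_zero_iff k t).1 h)
  have h1 := congrArg (fun z => antipode k z * ((f t)⁻¹ • a)) (sum_antipode_mul_contract t f)
  simp only [map_sum, antipode_mul_antidistrib, Finset.sum_mul, map_smul, antipode_one,
    smul_mul_smul_comm, one_mul, mul_inv_cancel₀ hf, one_smul,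
    ht.antipode_contract_mul] at h1
  exact ⟨_, by rw [map_sum, map_sum]; exact h1⟩

theorem IsLeftIntegral.contract_surjective {t : A} (ht : IsLeftIntegral k t)
    (h0 : t ≠ 0) (hS : Function.Injective (antipode k (A := A))) :
    Function.Surjective (contract k t) := fun a =>
  (ht.antipode_contract_surjective h0 (antipode k a)).imp fun _ hf => hS hf

variable (k A) in
theorem antipode_bijective : Function.Bijective (antipode k (A := A)) := by
  obtain ⟨t, h0, ht⟩ := exists_isLeftIntegral k (A := A)
  have hs : Function.Surjective (antipode k (A := A)) := fun a =>
    let ⟨f, hf⟩ := ht.antipode_contract_surjective h0 a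
    ⟨_, hf⟩
  exact ⟨LinearMap.injective_iff_surjective.2 hs, hs⟩

theorem IsLeftIntegral.contract_bijective {t : A} (ht : IsLeftIntegral k t)
    (h0 : t ≠ 0) : Function.Bijective (contract k t) := by
  have hs := ht.contract_surjective h0 (antipode_bijective k A).1
  exact ⟨(LinearMap.injective_iff_surjective_of_finrank_eq_finrank
    (Subspace.dual_finrank_eq)).2 hs, hs⟩

end Integral

end HopfRep

namespace HopfRep

/-! ### Frobenius forms and coinduction -/

section FrobeniusForm

variable {k A : Type*} [Field k] [Ring A] [Algebra k A]

/-- A linear form whose kernel contains no nonzero right ideal. -/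
def IsFrobeniusForm (l : Dual k A) : Prop := ∀ a, (∀ x, l (a * x) = 0) → a = 0

variable [FiniteDimensional k A] {l : Dual k A}

theorem IsFrobeniusForm.exists_left (hl : IsFrobeniusForm l) (f : Dual k A) :
    ∃ a, ∀ x, f x = l (a * x) := by
  let φ : A →ₗ[k] Dual k A := LinearMap.mul k A |>.compr₂ l
  have hφ : Function.Injective φ := (injective_iff_map_eq_zero φ).2 fun a ha =>
    hl a fun x => LinearMap.congr_fun ha x
  obtain ⟨a, ha⟩ := (LinearMap.injective_iff_surjective_of_finrank_eq_finrank
    (Subspace.dual_finrank_eq).symm).1 hφ f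
  exact ⟨a, fun x => (LinearMap.congr_fun ha x).symm⟩

theorem IsFrobeniusForm.eq_zero_of_mul_right (hl : IsFrobeniusForm l) (a : A)
    (h : ∀ x, l (x * a) = 0) : a = 0 :=
  (Module.forall_dual_apply_eq_zero_iff k a).1 fun f => by
    obtain ⟨b, hb⟩ := hl.exists_left f
    rw [hb, h]

theorem IsFrobeniusForm.exists_right (hl : IsFrobeniusForm l) (f : Dual k A) :
    ∃ a, ∀ x, f x = l (x * a) := by
  let φ : A →ₗ[k] Dual k A := (LinearMap.mul k A).flip |>.compr₂ l
  have hφ : Function.Injective φ := (injective_iff_map_eq_zero φ).2 fun a ha =>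
    hl.eq_zero_of_mul_right a fun x => LinearMap.congr_fun ha x
  obtain ⟨a, ha⟩ := (LinearMap.injective_iff_surjective_of_finrank_eq_finrank
    (Subspace.dual_finrank_eq).symm).1 hφ f
  exact ⟨a, fun x => (LinearMap.congr_fun ha x).symm⟩

theorem IsFrobeniusForm.ext_left (hl : IsFrobeniusForm l) {a b : A}
    (h : ∀ x, l (x * a) = l (x * b)) : a = b :=
  sub_eq_zero.1 (hl.eq_zero_of_mul_right _ fun x => by rw [mul_sub, map_sub, h, sub_self])

/-- Along an algebra map `i : A → H`, every linear form on `H` corresponds to a left `A`-linear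
map `H → A`. -/
theorem IsFrobeniusForm.exists_coinduced {H : Type*} [Ring H] [Algebra k H] (hl : IsFrobeniusForm l)
    (i : A →ₐ[k] H) (f : Dual k H) :
    ∃ q : H →ₗ[k] A, (∀ a h, l (a * q h) = f (i a * h)) ∧ ∀ a h, q (i a * h) = a * q h := by
  choose q hq using fun h : H =>
    hl.exists_right (f ∘ₗ LinearMap.mulRight k h ∘ₗ i.toLinearMap)
  have hq' : ∀ h a, l (a * q h) = f (i a * h) := fun h a => (hq h a).symm
  refine ⟨⟨⟨q, fun x y => hl.ext_left fun a => ?_⟩, fun c x => hl.ext_left fun a => ?_⟩,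
    fun a h => hq' h a, fun a h => hl.ext_left fun b => ?_⟩
  · simp [mul_add, hq']
  · simp [hq']
  · change l (b * q _) = l (b * (a * q h))
    rw [hq', ← mul_assoc b a, hq', map_mul i, mul_assoc]

end FrobeniusForm

/-! ### Nakayama automorphism, uniqueness of integrals, modular functions -/

section Modular

universe u

variable {k : Type*} {A : Type u} [Field k] [Ring A] [HopfAlgebra k A] [FiniteDimensional k A]

/-- Take `l` with `l(t₁) t₂ = 1`. Then `l(S(a) ·)` contracts to `a`, which gives nondegeneracy. For
the commutation rule, contract `l(· a)` using the formula for `Δ(t)(a ⊗ 1)` and compare. The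
representation `r` of `Δ(a)` is arbitrary so that it may later be one transported along an
embedding. -/
theorem IsLeftIntegral.exists_frobeniusForm {t : A} (ht : IsLeftIntegral k t) (h0 : t ≠ 0) :
    ∃ l : Dual k A, IsFrobeniusForm l ∧ contract k t l = 1 ∧
      ∀ α : A → k, (∀ a, t * a = α a • t) → ∀ (a : A) (ι : Type u) (r : Coalgebra.Repr k a ι),
        ∀ x, l (x * a) =
          l (antipode k (∑ i ∈ r.index, α (r.left i) • antipode k (r.right i)) * x) := by
  obtain ⟨l, hl⟩ := (ht.contract_bijective h0).2 1
  have hmul : ∀ a, contract k t (l ∘ₗ LinearMap.mulLeft k (antipode k a)) = a := fun a => by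
    rw [← ht.mul_contract, hl, mul_one]
  refine ⟨l, fun a ha => ?_, hl, fun α hα a ι r => ?_⟩
  · obtain ⟨b, rfl⟩ := (antipode_bijective k A).2 a
    rw [← hmul b, show l ∘ₗ LinearMap.mulLeft k (antipode k b) = 0 from LinearMap.ext ha,
      map_zero, map_zero]
  · have h1 : contract k t (l ∘ₗ LinearMap.mulRight k a) =
        ∑ i ∈ r.index, α (r.left i) • antipode k (r.right i) := by
      have h := congrArg (fun z => TensorProduct.lid k A (l.rTensor A z))
        (comul_mul_tmul_one hα r)
      simp only [lid_rTensor_mul_right, map_sum, map_smul, mul_one, LinearMap.mulRight_one,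
        LinearMap.comp_id, ← contract_apply, hl, one_mul] at h
      exact h
    have h2 : l ∘ₗ LinearMap.mulRight k a = l ∘ₗ LinearMap.mulLeft k (antipode k
        (∑ i ∈ r.index, α (r.left i) • antipode k (r.right i))) :=
      (ht.contract_bijective h0).1 (by rw [hmul, h1])
    exact LinearMap.congr_fun h2

theorem IsLeftIntegral.antipode {t : A} (ht : IsLeftIntegral k t) :
    IsRightIntegral k (antipode k t) := by
  intro a
  obtain ⟨b, rfl⟩ := (antipode_bijective k A).2 a
  rw [← antipode_mul_antidistrib, ht, map_smul, counit_antipode]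

/-- Since `S(u)` is a right integral, `l(S(u) ·) = l(S(u)) ε`. The left side contracts to `u`, the
right side to `l(S(u)) t`. -/
theorem IsLeftIntegral.exists_smul_eq {t : A} (ht : IsLeftIntegral k t) (h0 : t ≠ 0) {u : A}
    (hu : IsLeftIntegral k u) : ∃ c : k, u = c • t := by
  obtain ⟨l, -, hl, -⟩ := ht.exists_frobeniusForm h0
  refine ⟨l (HopfAlgebra.antipode k u), ?_⟩
  have h1 : contract k t (l ∘ₗ LinearMap.mulLeft k (HopfAlgebra.antipode k u)) = u := by
    rw [← ht.mul_contract, hl, mul_one]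
  have h2 : l ∘ₗ LinearMap.mulLeft k (HopfAlgebra.antipode k u) =
      l (HopfAlgebra.antipode k u) • (counit : A →ₗ[k] k) := by
    ext x
    simp [hu.antipode x, mul_comm]
  rw [h2, map_smul, contract_eq_sum (ℛ k t), sum_counit_smul] at h1
  exact h1.symm

theorem IsLeftIntegral.mul_eq_antipode_smul {t : A} (ht : IsLeftIntegral k t) {m : A → k}
    (hm : IsRightModularFunction k m) (a : A) : t * a = m (HopfAlgebra.antipode k a) • t := by
  apply (antipode_bijective k A).1
  rw [antipode_mul_antidistrib, hm _ ht.antipode, map_smul]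

variable (k A) in
theorem exists_isRightIntegral : ∃ t : A, t ≠ 0 ∧ IsRightIntegral k t := by
  obtain ⟨t, h0, ht⟩ := exists_isLeftIntegral k (A := A)
  exact ⟨_, by simpa using (antipode_bijective k A).1.ne h0, ht.antipode⟩

theorem exists_smul_eq_of_isRightIntegral {t u : A} (ht : IsRightIntegral k t) (h0 : t ≠ 0)
    (hu : IsRightIntegral k u) : ∃ c : k, u = c • t := by
  have hS := antipode_bijective k A
  have hleft : ∀ v, IsRightIntegral k (antipode k v) → IsLeftIntegral k v := fun v hv a => by
    apply hS.1
    rw [antipode_mul_antidistrib, hv, map_smul, counit_antipode]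
  obtain ⟨t, rfl⟩ := hS.2 t
  obtain ⟨u, rfl⟩ := hS.2 u
  have h0' : t ≠ 0 := by rintro rfl; simp at h0
  obtain ⟨c, hc⟩ := (hleft t ht).exists_smul_eq h0' (hleft u hu)
  exact ⟨c, by rw [hc, map_smul]⟩

variable (k A) in
theorem existsUnique_isRightModularFunction : ∃! m : A → k, IsRightModularFunction k m := by
  obtain ⟨t, h0, ht⟩ := exists_isRightIntegral k A
  choose m hm using fun a => exists_smul_eq_of_isRightIntegral ht h0 (u := a * t)
    fun b => by rw [mul_assoc, ht, mul_smul_comm]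
  refine ⟨m, fun u hu a => ?_, fun m' hm' => ?_⟩
  · obtain ⟨c, rfl⟩ := exists_smul_eq_of_isRightIntegral ht h0 hu
    rw [mul_smul_comm, hm, smul_comm]
  · funext a
    have := (hm' t ht a).symm.trans (hm a)
    exact smul_left_injective k h0 this

/-- For a Frobenius form, `l(a x) = m(a) l(x)` determines `x` from the scalar `l(x)`. -/
theorem exists_smul_eq_of_mul_eq {t x : A} (h0 : t ≠ 0) (m : A → k)
    (ht : ∀ a, a * t = m a • t) (hx : ∀ a, a * x = m a • x) : ∃ c : k, x = c • t := by
  obtain ⟨u, hu0, hu⟩ := exists_isLeftIntegral k (A := A)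
  obtain ⟨l, hl, -, -⟩ := hu.exists_frobeniusForm hu0
  have hlt : l t ≠ 0 := fun h => h0 (hl.eq_zero_of_mul_right t fun a => by
    rw [ht, map_smul, h, smul_zero])
  refine ⟨l x / l t, hl.ext_left fun a => ?_⟩
  rw [hx, mul_smul_comm, ht]
  simp only [map_smul, smul_eq_mul]
  field_simp

end Modular

end HopfRep

namespace HopfRep

/-! ### Invariants modulo the image of an integral -/

section Defect

variable {k A V W V' W' U : Type*} [Field k] [Ring A] [HopfAlgebra k A]
  [AddCommGroup V] [Module k V] [AddCommGroup W] [Module k W]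
  [AddCommGroup V'] [Module k V'] [AddCommGroup W'] [Module k W']
  [AddCommGroup U] [Module k U]

theorem tensorRep_map {ρ : A →ₐ[k] End k V} {σ : A →ₐ[k] End k W} {ρ' : A →ₐ[k] End k V'}
    {σ' : A →ₐ[k] End k W'} {f : V →ₗ[k] V'} {g : W →ₗ[k] W'} (hf : ∀ a v, f (ρ a v) = ρ' a (f v))
    (hg : ∀ a w, g (σ a w) = σ' a (g w)) (a : A) (x : V ⊗[k] W) :
    TensorProduct.map f g (tensorRep ρ σ a x) = tensorRep ρ' σ' a (TensorProduct.map f g x) := by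
  induction x with
  | zero => simp
  | add x y hx hy => simp only [map_add, hx, hy]
  | tmul v w => simp [tensorRep_tmul _ _ (ℛ k a), hf, hg]

theorem tensorRep_assoc (ρ : A →ₐ[k] End k V) (σ : A →ₐ[k] End k W) (τ : A →ₐ[k] End k U) (a : A)
    (x : (V ⊗[k] W) ⊗[k] U) :
    TensorProduct.assoc k V W U (tensorRep (tensorRep ρ σ) τ a x) =
      tensorRep ρ (tensorRep σ τ) a (TensorProduct.assoc k V W U x) := by
  induction x with
  | zero => simp
  | add x y hx hy => simp only [map_add, hx, hy]
  | tmul x u =>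
    induction x with
    | zero => simp
    | add x y hx hy => simp only [TensorProduct.add_tmul, map_add, hx, hy]
    | tmul v w =>
      have key := congrArg (TensorProduct.map (LinearMap.applyₗ v ∘ₗ ρ.toLinearMap)
        (TensorProduct.map (LinearMap.applyₗ w ∘ₗ σ.toLinearMap)
          (LinearMap.applyₗ u ∘ₗ τ.toLinearMap)))
        (sum_tmul_tmul_eq (ℛ k a) (fun i => ℛ k _) (fun i => ℛ k _))
      simp only [map_sum, TensorProduct.map_tmul, LinearMap.comp_apply,
        LinearMap.applyₗ_apply_apply, AlgHom.toLinearMap_apply] at key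
      rw [tensorRep_tmul _ _ (ℛ k a), TensorProduct.assoc_tmul, tensorRep_tmul _ _ (ℛ k a)]
      simp only [fun i => tensorRep_tmul ρ σ (ℛ k ((ℛ k a).left i)),
        fun i => tensorRep_tmul σ τ (ℛ k ((ℛ k a).right i)), TensorProduct.sum_tmul,
        TensorProduct.tmul_sum, map_sum, TensorProduct.assoc_tmul]
      exact key

theorem tensorRep_comp {H : Type*} [Ring H] [HopfAlgebra k H] (i : A →ₐc[k] H)
    (ρ : H →ₐ[k] End k V) (σ : H →ₐ[k] End k W) (a : A) :
    tensorRep (ρ.comp (i : A →ₐ[k] H)) (σ.comp (i : A →ₐ[k] H)) a = tensorRep ρ σ (i a) := by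
  have h : ∑ j ∈ (ℛ k a).index, i ((ℛ k a).left j) ⊗ₜ[k] i ((ℛ k a).right j) =
      comul (R := k) (i a) := by
    rw [← CoalgHomClass.map_comp_comul_apply, ← (ℛ k a).eq]
    simp
  rw [tensorRep_apply _ _ (ℛ k a), tensorRep_apply _ _
    ⟨(ℛ k a).index, fun j => i ((ℛ k a).left j), fun j => i ((ℛ k a).right j), h⟩]
  rfl

theorem tensorRep_lmul_apply (a : A) (z : A ⊗[k] A) :
    tensorRep (Algebra.lmul k A) (Algebra.lmul k A) a z = comul a * z := by
  induction z with
  | zero => simp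
  | add x y hx hy => simp only [map_add, mul_add, hx, hy]
  | tmul x y =>
    rw [tensorRep_tmul _ _ (ℛ k a), ← (ℛ k a).eq, Finset.sum_mul]
    simp

/-- The vectors on which `A` acts through the counit. -/
def invariants (ρ : A →ₐ[k] End k V) : Submodule k V where
  carrier := {v | ∀ a, ρ a v = counit (R := k) a • v}
  add_mem' hx hy a := by rw [map_add, hx, hy, smul_add]
  zero_mem' a := by simp
  smul_mem' c x hx a := by rw [map_smul, hx, smul_comm]

/-- The invariants modulo those of the form `t v`. -/
abbrev InvQuot (ρ : A →ₐ[k] End k V) (t : A) : Type _ :=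
  invariants ρ ⧸ (LinearMap.range (ρ t)).comap (invariants ρ).subtype

/-- The `A`-action on the first factor of a tensor product. -/
noncomputable def rTensorRep (ρ : A →ₐ[k] End k V) (U : Type*) [AddCommGroup U] [Module k U] :
    A →ₐ[k] End k (V ⊗[k] U) :=
  (Module.End.rTensorAlgHom k V U).comp ρ

theorem rTensorRep_apply (ρ : A →ₐ[k] End k V) (a : A) :
    rTensorRep ρ U a = (ρ a).rTensor U := rfl

theorem finrank_quotient_le_of_comap_le {M N : Type*} [AddCommGroup M] [Module k M]
    [AddCommGroup N] [Module k N] [FiniteDimensional k M] [FiniteDimensional k N] (f : M →ₗ[k] N)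
    {p : Submodule k M} {q : Submodule k N} (h : q.comap f ≤ p) :
    finrank k (M ⧸ p) ≤ finrank k (N ⧸ q) := by
  have h1 : finrank k (M ⧸ p) ≤ finrank k (M ⧸ LinearMap.ker (q.mkQ ∘ₗ f)) := by
    have h' : LinearMap.ker (q.mkQ ∘ₗ f) ≤ p := by rwa [LinearMap.ker_comp, Submodule.ker_mkQ]
    exact LinearMap.finrank_le_finrank_of_surjective (Submodule.factor_surjective h')
  exact h1.trans ((LinearEquiv.finrank_eq (LinearMap.quotKerEquivRange _)).trans_le
    (Submodule.finrank_le _))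

variable [FiniteDimensional k V] [FiniteDimensional k V'] [FiniteDimensional k U]

/-- `I ∘ P` need only be the identity on invariants up to `tV`. This covers isomorphisms and also
the removal of a summand without defect. -/
theorem finrank_invQuot_le {ρ : A →ₐ[k] End k V} {ρ' : A →ₐ[k] End k V'} {t : A}
    (P : V →ₗ[k] V') (I : V' →ₗ[k] V) (hP : ∀ a v, P (ρ a v) = ρ' a (P v))
    (hI : ∀ a v, I (ρ' a v) = ρ a (I v))
    (h : ∀ x ∈ invariants ρ, x - I (P x) ∈ LinearMap.range (ρ t)) :
    finrank k (InvQuot ρ t) ≤ finrank k (InvQuot ρ' t) := by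
  refine finrank_quotient_le_of_comap_le
    (P.restrict (p := invariants ρ) (q := invariants ρ') fun x hx a => ?_) fun x hx => ?_
  · rw [← hP, hx, map_smul]
  · obtain ⟨y, hy⟩ := hx
    obtain ⟨z, hz⟩ := h x x.2
    refine ⟨z + I y, ?_⟩
    change ρ' t y = P x at hy
    rw [map_add, hz, ← hI, hy]
    simp

theorem finrank_mul_finrank_invQuot_le (ρ : A →ₐ[k] End k V) (t : A) :
    finrank k U * finrank k (InvQuot ρ t) ≤ finrank k (InvQuot (rTensorRep ρ U) t) := by
  classical
  let b := Module.finBasis k U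
  let e := TensorProduct.equivFinsuppOfBasisRight (M := V) b
  let F : (Fin (finrank k U) → invariants ρ) →ₗ[k] V ⊗[k] U :=
    ∑ j, (TensorProduct.mk k V U).flip (b j) ∘ₗ (invariants ρ).subtype ∘ₗ LinearMap.proj j
  have hF : ∀ x, F x = ∑ j, (x j : V) ⊗ₜ[k] b j := fun x => by simp [F]
  have hFinv : ∀ x, F x ∈ invariants (rTensorRep ρ U) := fun x a => by
    rw [hF, rTensorRep_apply, map_sum, Finset.smul_sum]
    exact Finset.sum_congr rfl fun j _ => by
      rw [LinearMap.rTensor_tmul, (x j).2 a, TensorProduct.smul_tmul']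
  have heF : ∀ x j, e (F x) j = x j := fun x j => by
    simp [hF, e, Finsupp.single_apply]
  have hemul : ∀ z j, e ((ρ t).rTensor U z) j = ρ t (e z j) := by
    intro z j
    induction z with
    | zero => simp
    | add x y hx hy => simp only [map_add, Finsupp.add_apply, hx, hy]
    | tmul x u =>
      simp only [LinearMap.rTensor_tmul, e,
        TensorProduct.equivFinsuppOfBasisRight_apply_tmul_apply, map_smul]
  have h1 : finrank k ((Fin (finrank k U) → invariants ρ) ⧸ Submodule.pi Set.univ
      fun _ => (LinearMap.range (ρ t)).comap (invariants ρ).subtype) =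
      finrank k U * finrank k (InvQuot ρ t) := by
    rw [LinearEquiv.finrank_eq (Submodule.quotientPi _), Module.finrank_pi_fintype]
    simp
  rw [← h1]
  refine finrank_quotient_le_of_comap_le (F.codRestrict _ hFinv) fun x hx j _ => ?_
  obtain ⟨z, hz⟩ := hx
  change (ρ t).rTensor U z = F x at hz
  exact ⟨e z j, by rw [← hemul, hz, heF]; rfl⟩

theorem invariants_le_of_finrank_eq_zero {ρ : A →ₐ[k] End k V} {t : A}
    (h : finrank k (InvQuot ρ t) = 0) : invariants ρ ≤ LinearMap.range (ρ t) := by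
  have h1 := Module.finrank_zero_iff.1 h
  rw [Submodule.Quotient.subsingleton_iff] at h1
  intro x hx
  have : (⟨x, hx⟩ : invariants ρ) ∈ (LinearMap.range (ρ t)).comap (invariants ρ).subtype := by
    rw [h1]; trivial
  exact this

end Defect

/-! ### Free modules have no defect -/

section Free

universe u

variable {k V W X : Type*} {A : Type u} [Field k] [Ring A] [HopfAlgebra k A] [FiniteDimensional k A]
  [AddCommGroup V] [Module k V] [AddCommGroup W] [Module k W] [AddCommGroup X] [Module k X]

/-- The coordinates of an invariant of `A ⊗ V` are left integrals, hence multiples of `t`. -/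
theorem invariants_le_of_free {ρ : A →ₐ[k] End k X} {t : A} (ht : IsLeftIntegral k t) (h0 : t ≠ 0)
    (e : A ⊗[k] V →ₗ[k] X) (he : Function.Bijective e)
    (hmul : ∀ a b v, e ((a * b) ⊗ₜ v) = ρ a (e (b ⊗ₜ v))) :
    invariants ρ ≤ LinearMap.range (ρ t) := by
  classical
  intro x hx
  obtain ⟨z, rfl⟩ := he.2 x
  have hmul' : ∀ a z, e ((LinearMap.mulLeft k a).rTensor V z) = ρ a (e z) := by
    intro a z
    induction z with
    | zero => simp
    | add x y hx hy => simp only [map_add, hx, hy]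
    | tmul b v => simp [hmul]
  have hz : ∀ a, (LinearMap.mulLeft k a).rTensor V z = counit (R := k) a • z := fun a =>
    he.1 (by rw [hmul', hx, map_smul])
  let b := Basis.ofVectorSpace k V
  let E := TensorProduct.equivFinsuppOfBasisRight (M := A) b
  have hEmul : ∀ a z j, E ((LinearMap.mulLeft k a).rTensor V z) j = a * E z j := by
    intro a z j
    induction z with
    | zero => simp
    | add x y hx hy => simp only [map_add, Finsupp.add_apply, hx, hy, mul_add]
    | tmul x u => simp [E]
  have hc : ∀ j, ∃ c : k, E z j = c • t := fun j => ht.exists_smul_eq h0 fun a => by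
    rw [← hEmul, hz, map_smul, Finsupp.smul_apply]
  choose c hc using hc
  refine ⟨e (∑ j ∈ (E z).support, c j • (1 ⊗ₜ b j)), ?_⟩
  rw [← hmul']
  congr 1
  have hz2 : z = ∑ j ∈ (E z).support, E z j ⊗ₜ[k] b j := by
    conv_lhs => rw [← E.symm_apply_apply z]
    simp only [E, TensorProduct.equivFinsuppOfBasisRight_symm_apply]
    rfl
  conv_rhs => rw [hz2]
  simp [hc, TensorProduct.smul_tmul']

variable [FiniteDimensional k V] [FiniteDimensional k W]

/-- `V ⊗ A ⊗ W` is free on the vectors `v ⊗ 1 ⊗ w`: untwist `W` with the Galois map and `V` with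
`S⁻¹`. Surjectivity suffices, the dimensions being equal. -/
theorem invariants_tensorRep_lmul_le {t : A} (ht : IsLeftIntegral k t) (h0 : t ≠ 0)
    (σ : A →ₐ[k] End k V) (τ : A →ₐ[k] End k W) :
    invariants (tensorRep (tensorRep σ (Algebra.lmul k A)) τ) ≤
      LinearMap.range (tensorRep (tensorRep σ (Algebra.lmul k A)) τ t) := by
  let Θ : A ⊗[k] (V ⊗[k] W) →ₗ[k] (V ⊗[k] A) ⊗[k] W :=
    (twistRight σ.toLinearMap).rTensor W ∘ₗ (TensorProduct.assoc k V A W).symm.toLinearMap ∘ₗ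
      (galoisEquiv τ).toLinearMap.lTensor V ∘ₗ (TensorProduct.leftComm k A V W).toLinearMap
  have hΘ : ∀ a v w, Θ (a ⊗ₜ (v ⊗ₜ w)) =
      tensorRep (tensorRep σ (Algebra.lmul k A)) τ a ((v ⊗ₜ 1) ⊗ₜ w) := by
    intro a v w
    have h1 : ∀ b, twistRight σ.toLinearMap (v ⊗ₜ b) =
        tensorRep σ (Algebra.lmul k A) b (v ⊗ₜ 1) := fun b => by
      rw [twistRight_tmul _ (ℛ k b), tensorRep_tmul _ _ (ℛ k b)]
      simp
    simp only [Θ, LinearMap.comp_apply, LinearEquiv.coe_coe, TensorProduct.leftComm_tmul,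
      LinearMap.lTensor_tmul]
    rw [galoisEquiv_tmul, tensorRep_tmul _ _ (ℛ k a), tensorRep_tmul _ _ (ℛ k a)]
    simp [TensorProduct.tmul_sum, h1]
  have hs : Function.Surjective Θ :=
    (LinearMap.rTensor_surjective W (twistRight_surjective σ (antipode_bijective k A))).comp
      ((TensorProduct.assoc k V A W).symm.surjective.comp
        ((LinearMap.lTensor_surjective V (galoisEquiv τ).surjective).comp
          (TensorProduct.leftComm k A V W).surjective))
  have hb : Function.Bijective Θ :=
    ⟨(LinearMap.injective_iff_surjective_of_finrank_eq_finrank (by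
      simp only [finrank_tensorProduct]; ring)).2 hs, hs⟩
  refine invariants_le_of_free ht h0 Θ hb fun a b x => ?_
  induction x with
  | zero => simp
  | add x y hx hy => simp only [TensorProduct.tmul_add, map_add, hx, hy]
  | tmul v w => rw [hΘ, hΘ, map_mul]; rfl

end Free

end HopfRep

/-! ### Vanishing of the defect along an embedding of Hopf algebras -/

namespace HopfRep

universe u v

variable {k : Type*} {A : Type v} {H : Type u} [Field k] [Ring A] [HopfAlgebra k A]
  [FiniteDimensional k A] [Ring H] [HopfAlgebra k H] [FiniteDimensional k H]

/-- `H` as a representation of `A` along a bialgebra map `i : A → H`. -/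
noncomputable def restrictedRep (i : A →ₐc[k] H) : A →ₐ[k] End k H :=
  (Algebra.lmul k H).comp (i : A →ₐ[k] H)

omit [FiniteDimensional k A] [FiniteDimensional k H] in
theorem restrictedRep_apply (i : A →ₐc[k] H) (a : A) (h : H) : restrictedRep i a h = i a * h := rfl

omit [FiniteDimensional k H] in
-- Self-injectivity of a Frobenius algebra: for a linear retraction `g` of `i`, the `A`-linear map
-- attached to `l ∘ g` is again a retraction.
theorem exists_leftInverse_linear (i : A →ₐc[k] H) (hi : Function.Injective i) :
    ∃ q : H →ₗ[k] A, (∀ a h, q (i a * h) = a * q h) ∧ ∀ a, q (i a) = a := by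
  obtain ⟨t, h0, ht⟩ := exists_isLeftIntegral k (A := A)
  obtain ⟨l, hl, -, -⟩ := ht.exists_frobeniusForm h0
  obtain ⟨g, hg⟩ := LinearMap.exists_leftInverse_of_injective (i : A →ₐ[k] H).toLinearMap
    (LinearMap.ker_eq_bot.2 hi)
  obtain ⟨q, hq, hq'⟩ := hl.exists_coinduced (i : A →ₐ[k] H) (l ∘ₗ g)
  refine ⟨q, hq', fun a => hl.ext_left fun b => ?_⟩
  have h1 : ∀ x, g (i x) = x := fun x => LinearMap.congr_fun hg x
  rw [hq]
  change l (g (i b * i a)) = _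
  rw [← map_mul, h1]

variable (i : A →ₐc[k] H)

section

variable {V : Type*} [AddCommGroup V] [Module k V] [FiniteDimensional k V]

omit [FiniteDimensional k A] in
-- The Galois map of `H` is `H`-linear, hence `A`-linear, and makes the action on the last factor
-- trivial, leaving `dim H` copies of `V ⊗ H`.
theorem finrank_mul_finrank_invQuot_le_tensorRep (σ : A →ₐ[k] End k V) (t : A) :
    finrank k H * finrank k (InvQuot (tensorRep σ (restrictedRep i)) t) ≤
      finrank k (InvQuot (tensorRep (tensorRep σ (restrictedRep i)) (restrictedRep i)) t) := by
  refine (finrank_mul_finrank_invQuot_le (U := H) _ t).trans ?_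
  let γ : (V ⊗[k] H) ⊗[k] H ≃ₗ[k] (V ⊗[k] H) ⊗[k] H :=
    TensorProduct.assoc k V H H ≪≫ₗ (galoisEquiv (Algebra.lmul k H)).lTensor V ≪≫ₗ
      (TensorProduct.assoc k V H H).symm
  have hγ : ∀ a x, γ (rTensorRep (tensorRep σ (restrictedRep i)) H a x) =
      tensorRep (tensorRep σ (restrictedRep i)) (restrictedRep i) a (γ x) := by
    intro a x
    rw [rTensorRep_apply]
    apply (TensorProduct.assoc k V H H).injective
    rw [tensorRep_assoc]
    simp only [γ, LinearEquiv.trans_apply, LinearEquiv.apply_symm_apply]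
    induction x with
    | zero => simp
    | add x y hx hy => simp only [map_add, hx, hy]
    | tmul x g =>
      induction x with
      | zero => simp
      | add x y hx hy => simp only [TensorProduct.add_tmul, map_add, hx, hy]
      | tmul v h =>
        rw [LinearMap.rTensor_tmul, tensorRep_tmul _ _ (ℛ k a)]
        simp only [TensorProduct.sum_tmul, map_sum, TensorProduct.assoc_tmul,
          LinearEquiv.lTensor_tmul]
        rw [tensorRep_tmul _ _ (ℛ k a)]
        refine Finset.sum_congr rfl fun j _ => ?_
        rw [restrictedRep, tensorRep_comp, ← galoisEquiv_map_mul]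
        rfl
  refine finrank_invQuot_le γ.toLinearMap γ.symm.toLinearMap hγ (fun a v => ?_) fun x _ => ?_
  · apply γ.injective
    simp [hγ]
  · simp

variable {i} {q : H →ₗ[k] A}

/-- The kernel of an `A`-linear map `H → A`, as a representation. -/
noncomputable def kerRep (hq : ∀ a h, q (i a * h) = a * q h) :
    A →ₐ[k] End k (LinearMap.ker q) :=
  AlgHom.ofLinearMap
    { toFun := fun a => (restrictedRep i a).restrict (p := LinearMap.ker q) (q := LinearMap.ker q)
        fun x hx => by
          rw [LinearMap.mem_ker] at hx ⊢
          rw [restrictedRep_apply, hq, hx, mul_zero]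
      map_add' := fun a b => by ext x; simp
      map_smul' := fun c a => by ext x; simp }
    (by ext x; simp)
    (fun a b => by ext x; simp)

omit [FiniteDimensional k A] [FiniteDimensional k H] in
theorem coe_kerRep_apply (hq : ∀ a h, q (i a * h) = a * q h) (a : A) (x : LinearMap.ker q) :
    (kerRep hq a x : H) = i a * x := rfl

/-- Split the middle factor as `H = i(A) ⊕ ker q`; the part `V ⊗ A ⊗ H` is free and contributes
nothing. -/
theorem finrank_invQuot_le_kerRep (hq : ∀ a h, q (i a * h) = a * q h) (hqi : ∀ a, q (i a) = a)
    {t : A} (ht : IsLeftIntegral k t) (h0 : t ≠ 0) (σ : A →ₐ[k] End k V) :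
    finrank k (InvQuot (tensorRep (tensorRep σ (restrictedRep i)) (restrictedRep i)) t) ≤
      finrank k (InvQuot (tensorRep (tensorRep σ (kerRep hq)) (restrictedRep i)) t) := by
  let j : A →ₗ[k] H := (i : A →ₐ[k] H).toLinearMap
  let p : H →ₗ[k] LinearMap.ker q := (LinearMap.id - j ∘ₗ q).codRestrict _ fun h => by
    simp [j, hqi]
  have hp : ∀ h, (p h : H) = h - i (q h) := fun h => rfl
  have hpa : ∀ a h, p (restrictedRep i a h) = kerRep hq a (p h) := fun a h => by
    ext
    rw [coe_kerRep_apply, hp, hp, restrictedRep_apply, hq, map_mul, mul_sub]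
  refine finrank_invQuot_le
    (TensorProduct.map (TensorProduct.map LinearMap.id p) LinearMap.id)
    (TensorProduct.map (TensorProduct.map LinearMap.id (LinearMap.ker q).subtype) LinearMap.id)
    (tensorRep_map (tensorRep_map (fun _ _ => rfl) hpa) fun _ _ => rfl)
    (tensorRep_map (tensorRep_map (fun _ _ => rfl) fun _ _ => rfl) fun _ _ => rfl) fun x hx => ?_
  let Q : (V ⊗[k] H) ⊗[k] H →ₗ[k] (V ⊗[k] A) ⊗[k] H :=
    TensorProduct.map (TensorProduct.map LinearMap.id q) LinearMap.id
  let J : (V ⊗[k] A) ⊗[k] H →ₗ[k] (V ⊗[k] H) ⊗[k] H :=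
    TensorProduct.map (TensorProduct.map LinearMap.id j) LinearMap.id
  have hQ : ∀ a x, Q (tensorRep (tensorRep σ (restrictedRep i)) (restrictedRep i) a x) =
      tensorRep (tensorRep σ (Algebra.lmul k A)) (restrictedRep i) a (Q x) :=
    tensorRep_map (tensorRep_map (fun _ _ => rfl) hq) fun _ _ => rfl
  have hJ : ∀ a x, J (tensorRep (tensorRep σ (Algebra.lmul k A)) (restrictedRep i) a x) =
      tensorRep (tensorRep σ (restrictedRep i)) (restrictedRep i) a (J x) :=
    tensorRep_map (tensorRep_map (fun _ _ => rfl) fun a b => map_mul i a b) fun _ _ => rfl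
  have hx' : Q x ∈ invariants (tensorRep (tensorRep σ (Algebra.lmul k A)) (restrictedRep i)) :=
    fun a => by rw [← hQ, hx, map_smul]
  obtain ⟨y, hy⟩ := invariants_tensorRep_lmul_le ht h0 σ (restrictedRep i) hx'
  refine ⟨J y, ?_⟩
  rw [← hJ, hy, eq_sub_iff_add_eq]
  have hsum : J ∘ₗ Q + (TensorProduct.map (TensorProduct.map LinearMap.id
      (LinearMap.ker q).subtype) LinearMap.id ∘ₗ TensorProduct.map
      (TensorProduct.map LinearMap.id p) LinearMap.id) = LinearMap.id := by
    ext v h g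
    simp [J, Q, j, hp, ← TensorProduct.add_tmul, ← TensorProduct.tmul_add]
  exact LinearMap.congr_fun hsum x

end

variable {i}

theorem pow_mul_finrank_invQuot_le {q : H →ₗ[k] A} (hq : ∀ a h, q (i a * h) = a * q h)
    (hqi : ∀ a, q (i a) = a) {t : A} (ht : IsLeftIntegral k t) (h0 : t ≠ 0) (m : ℕ)
    {V : Type u} [AddCommGroup V] [Module k V] [FiniteDimensional k V] (σ : A →ₐ[k] End k V) :
    finrank k H ^ m * finrank k (InvQuot (tensorRep σ (restrictedRep i)) t) ≤
      finrank k (LinearMap.ker q) ^ m * (finrank k V * finrank k H) := by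
  induction m generalizing V with
  | zero =>
    rw [pow_zero, pow_zero, one_mul, one_mul, ← finrank_tensorProduct]
    exact (Submodule.finrank_quotient_le _).trans (Submodule.finrank_le _)
  | succ m ih =>
    calc _ = finrank k H ^ m * (finrank k H *
          finrank k (InvQuot (tensorRep σ (restrictedRep i)) t)) := by ring
      _ ≤ finrank k H ^ m *
          finrank k (InvQuot (tensorRep (tensorRep σ (kerRep hq)) (restrictedRep i)) t) :=
        Nat.mul_le_mul_left _ ((finrank_mul_finrank_invQuot_le_tensorRep i σ t).trans
          (finrank_invQuot_le_kerRep hq hqi ht h0 σ))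
      _ ≤ _ := ih _
      _ = _ := by rw [finrank_tensorProduct]; ring

theorem invariants_tensorRep_restrictedRep_le (hi : Function.Injective i) {t : A}
    (ht : IsLeftIntegral k t) (h0 : t ≠ 0) {V : Type u} [AddCommGroup V] [Module k V]
    [FiniteDimensional k V] (σ : A →ₐ[k] End k V) :
    invariants (tensorRep σ (restrictedRep i)) ≤
      LinearMap.range (tensorRep σ (restrictedRep i) t) := by
  obtain ⟨q, hq, hqi⟩ := exists_leftInverse_linear i hi
  apply invariants_le_of_finrank_eq_zero
  by_contra hne
  have hlt : finrank k (LinearMap.ker q) < finrank k H := by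
    have h1 := LinearMap.finrank_range_add_finrank_ker q
    have h2 : 0 < finrank k (LinearMap.range q) := by
      rw [finrank_pos_iff_exists_ne_zero]
      exact ⟨⟨t, i t, hqi t⟩, fun h => h0 (congrArg Subtype.val h)⟩
    omega
  have hn : (0 : ℝ) < finrank k H := by exact_mod_cast (Nat.zero_le _).trans_lt hlt
  -- This `m` gives `(dim ker q)^m (dim V dim H + 1) < (dim H)^m`, contradicting the iterated bound
  -- once the defect is at least `1`.
  obtain ⟨m, hm⟩ := exists_pow_lt_of_lt_one
    (show (0 : ℝ) < 1 / (finrank k V * finrank k H + 1) by positivity)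
    (show (finrank k (LinearMap.ker q) : ℝ) / finrank k H < 1 by
      rw [div_lt_one hn]; exact_mod_cast hlt)
  have h1 := pow_mul_finrank_invQuot_le hq hqi ht h0 m σ
  have h2 : (finrank k H : ℝ) ^ m ≤
      finrank k (LinearMap.ker q) ^ m * (finrank k V * finrank k H) := by
    exact_mod_cast (Nat.le_mul_of_pos_right _ (Nat.pos_of_ne_zero hne)).trans h1
  rw [div_pow, div_lt_div_iff₀ (by positivity) (by positivity), one_mul] at hm
  nlinarith [pow_nonneg (Nat.cast_nonneg (α := ℝ) (finrank k (LinearMap.ker q))) m]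

/-- For a left integral `Λ` of `H`, `Δ(Λ)` is `A`-invariant in `H ⊗ H`, so `Δ(Λ) = Δ(i t) w`. Then
`ε(h) Δ(Λ) = Δ(h) Δ(Λ) = Δ(h · i t) w = 0`. -/
theorem counit_eq_zero_of_mul_eq_zero (hi : Function.Injective i) {t : A}
    (ht : IsLeftIntegral k t) (h0 : t ≠ 0) {h : H} (hh : h * i t = 0) :
    counit (R := k) h = 0 := by
  obtain ⟨Λ, hΛ0, hΛ⟩ := exists_isLeftIntegral k (A := H)
  have hmem : comul (R := k) Λ ∈ invariants (tensorRep (restrictedRep i) (restrictedRep i)) := by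
    intro a
    rw [restrictedRep, tensorRep_comp, tensorRep_lmul_apply, ← Bialgebra.comul_mul, hΛ, map_smul,
      CoalgHomClass.counit_comp_apply]
  obtain ⟨w, hw⟩ := invariants_tensorRep_restrictedRep_le hi ht h0 _ hmem
  rw [restrictedRep, tensorRep_comp, tensorRep_lmul_apply] at hw
  have h1 : counit (R := k) h • comul (R := k) Λ = 0 := by
    rw [← map_smul, ← hΛ, Bialgebra.comul_mul, ← hw, ← mul_assoc, ← Bialgebra.comul_mul, hh,
      map_zero, zero_mul]
  refine (smul_eq_zero.1 h1).resolve_right fun h2 => hΛ0 ?_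
  have h3 := rTensor_counit_comul (R := k) Λ
  rw [h2, map_zero] at h3
  simpa using (congrArg (TensorProduct.lid k H) h3).symm

end HopfRep

/-! ### Projectivity and its consequences -/

namespace HopfRep

universe u

variable {k : Type*} {A H : Type u} [Field k] [Ring A] [HopfAlgebra k A]
  [FiniteDimensional k A] [Ring H] [HopfAlgebra k H] [FiniteDimensional k H] {i : A →ₐc[k] H}

/-- The counit kills the kernel of left multiplication by `i(S(t))`, so `ε = f(i(S(t)) ·)` for some
form `f`. If `q` is coinduced from `f`, then `l(S(t) q(h))` equals both `ε(h)` and `ε(q(h))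
l(S(t))`. -/
theorem exists_linear_counit (hi : Function.Injective i)
    (hS : ∀ a, i (antipode k a) = antipode k (i a)) :
    ∃ φ : H →ₗ[k] A, (∀ a h, φ (i a * h) = a * φ h) ∧
      ∀ h, counit (R := k) (φ h) = counit (R := k) h := by
  obtain ⟨t, h0, ht⟩ := exists_isLeftIntegral k (A := A)
  obtain ⟨l, hl, -, -⟩ := ht.exists_frobeniusForm h0
  have hker : (counit : H →ₗ[k] k) ∈
      (LinearMap.ker (LinearMap.mulLeft k (i (antipode k t)))).dualAnnihilator := by
    rw [Submodule.mem_dualAnnihilator]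
    intro h hh
    obtain ⟨h, rfl⟩ := (antipode_bijective k H).2 h
    rw [LinearMap.mem_ker, LinearMap.mulLeft_apply, hS, ← antipode_mul_antidistrib] at hh
    rw [counit_antipode]
    exact counit_eq_zero_of_mul_eq_zero hi ht h0
      ((antipode_bijective k H).1 (hh.trans (map_zero _).symm))
  rw [← LinearMap.range_dualMap_eq_dualAnnihilator_ker] at hker
  obtain ⟨f, hf⟩ := hker
  obtain ⟨q, hq, hq'⟩ := hl.exists_coinduced (i : A →ₐ[k] H) f
  refine ⟨l (antipode k t) • q, fun a h => ?_, fun h => ?_⟩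
  · rw [LinearMap.smul_apply, LinearMap.smul_apply, mul_smul_comm]
    exact congrArg _ (hq' a h)
  · have h1 := hq (antipode k t) h
    rw [ht.antipode (q h), map_smul] at h1
    rw [LinearMap.smul_apply, map_smul, smul_eq_mul, mul_comm, ← smul_eq_mul, h1]
    exact LinearMap.congr_fun hf h

/-- A finite-dimensional Hopf algebra is projective over the image of a Hopf algebra embedding. -/
theorem exists_projective_basis (hi : Function.Injective i)
    (hS : ∀ a, i (antipode k a) = antipode k (i a)) :
    ∃ (n : ℕ) (φ : Fin n → H →ₗ[k] A) (e : Fin n → H),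
      (∀ j a h, φ j (i a * h) = a * φ j h) ∧ ∀ h, ∑ j, i (φ j h) * e j = h := by
  classical
  obtain ⟨φ, hφ, hε⟩ := exists_linear_counit hi hS
  -- `D` is an `A`-linear section of `ε ⊗ id : A ⊗ H → H` for the diagonal action; `G⁻¹` makes `A ⊗
  -- H` free, and the coordinates of `G⁻¹ ∘ D` are the required maps.
  let G := galoisEquiv (restrictedRep i)
  let D : H →ₗ[k] A ⊗[k] H := φ.rTensor H ∘ₗ comul
  have hD : ∀ a h, D (i a * h) =
      tensorRep (Algebra.lmul k A) (restrictedRep i) a (D h) := by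
    intro a h
    refine Eq.trans ?_ (tensorRep_map (ρ := restrictedRep i) (σ := restrictedRep i)
      (ρ' := Algebra.lmul k A) (f := φ) (g := LinearMap.id) hφ (fun _ _ => rfl) a (comul h))
    rw [restrictedRep, tensorRep_comp, tensorRep_lmul_apply, ← Bialgebra.comul_mul]
    rfl
  let b := Module.finBasis k H
  let E := TensorProduct.equivFinsuppOfBasisRight (M := A) b
  have hE : ∀ a z j, E ((Algebra.lmul k A a).rTensor H z) j = a * E z j := by
    intro a z j
    induction z with
    | zero => simp
    | add x y hx hy => simp only [map_add, Finsupp.add_apply, hx, hy, mul_add]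
    | tmul x u => simp [E]
  let μ : A ⊗[k] H →ₗ[k] H := TensorProduct.lift (restrictedRep i).toLinearMap
  have hμ : ∀ z, μ z = TensorProduct.lid k H ((counit (R := k)).rTensor H (G z)) := by
    intro z
    induction z with
    | zero => simp
    | add x y hx hy => simp only [map_add, hx, hy]
    | tmul a h =>
      simp only [G]
      rw [galoisEquiv_tmul, tensorRep_tmul _ _ (ℛ k a)]
      conv_lhs => rw [← sum_counit_smul (ℛ k a)]
      simp [μ, TensorProduct.sum_tmul, ← TensorProduct.smul_tmul']
  refine ⟨finrank k H, fun j => Finsupp.lapply j ∘ₗ E.toLinearMap ∘ₗ G.symm.toLinearMap ∘ₗ D, b,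
    fun j a h => ?_, fun h => ?_⟩
  · simp only [LinearMap.comp_apply, LinearEquiv.coe_coe, Finsupp.lapply_apply]
    rw [hD, ← hE]
    congr 2
    apply G.injective
    simp only [G]
    rw [galoisEquiv_map_mul, LinearEquiv.apply_symm_apply, LinearEquiv.apply_symm_apply]
  · simp only [LinearMap.comp_apply, LinearEquiv.coe_coe, Finsupp.lapply_apply]
    have h1 : ∀ z, ∑ j, i (E z j) * b j = μ z := by
      intro z
      conv_rhs => rw [← E.symm_apply_apply z]
      simp only [E, TensorProduct.equivFinsuppOfBasisRight_symm_apply]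
      rw [Finsupp.sum_fintype _ _ (by simp), map_sum]
      rfl
    rw [h1, hμ, LinearEquiv.apply_symm_apply]
    have h2 : (counit (R := k)).rTensor H (D h) = (counit (R := k)).rTensor H (comul h) := by
      simp only [D, LinearMap.comp_apply]
      rw [← LinearMap.rTensor_comp_apply]
      congr 2
      exact LinearMap.ext hε
    rw [h2, rTensor_counit_comul]
    simp

/-- Each coordinate satisfies `ε(φⱼ(h)) t = t φⱼ(h) = φⱼ(i(t) h) = 0`. -/
theorem mem_span_of_mul_eq_zero (hi : Function.Injective i)
    (hS : ∀ a, i (antipode k a) = antipode k (i a)) {t : A} (ht : IsRightIntegral k t)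
    (h0 : t ≠ 0) {h : H} (hh : i t * h = 0) :
    h ∈ Submodule.span Hᵐᵒᵖ (i '' {a | counit (R := k) a = 0}) := by
  obtain ⟨n, φ, e, hφ, he⟩ := exists_projective_basis hi hS
  rw [← he h]
  refine Submodule.sum_mem _ fun j _ => Submodule.smul_mem _ (op (e j)) (Submodule.subset_span
    ⟨φ j h, ?_, rfl⟩)
  have h1 := hφ j t h
  rw [hh, map_zero, ht] at h1
  exact (smul_eq_zero.1 h1.symm).resolve_right h0

/-- The coordinates `φⱼ(x)` are eigenvectors in `A` with character `m`, hence multiples of `t`. -/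
theorem exists_eq_mul_of_mul_eq (hi : Function.Injective i)
    (hS : ∀ a, i (antipode k a) = antipode k (i a)) {t : A} (h0 : t ≠ 0) (m : A → k)
    (ht : ∀ a, a * t = m a • t) {x : H} (hx : ∀ a, i a * x = m a • x) : ∃ w, x = i t * w := by
  obtain ⟨n, φ, e, hφ, he⟩ := exists_projective_basis hi hS
  choose c hc using fun j => exists_smul_eq_of_mul_eq h0 m ht (x := φ j x) fun a => by
    rw [← hφ, hx, map_smul]
  refine ⟨∑ j, c j • e j, ?_⟩
  rw [Finset.mul_sum]
  conv_lhs => rw [← he x]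
  refine Finset.sum_congr rfl fun j _ => ?_
  rw [hc, map_smul, smul_mul_assoc, mul_smul_comm]

theorem isFrobeniusExtension_of_modular_eq (hi : Function.Injective i)
    (hS : ∀ a, i (antipode k a) = antipode k (i a)) {mA : A → k} {mH : H → k}
    (hmA : IsRightModularFunction k mA) (hmH : IsRightModularFunction k mH)
    (h : ∀ a, mH (i a) = mA a) :
    IsFrobeniusExtension ((i : A →ₐ[k] H) : A →+* H) := by
  obtain ⟨tA, htA0, htA⟩ := exists_isLeftIntegral k (A := A)
  obtain ⟨tH, htH0, htH⟩ := exists_isLeftIntegral k (A := H)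
  obtain ⟨lA, hlA, -, hnA⟩ := htA.exists_frobeniusForm htA0
  obtain ⟨lH, hlH, -, hnH⟩ := htH.exists_frobeniusForm htH0
  have hαA := htA.mul_eq_antipode_smul hmA
  have hαH := htH.mul_eq_antipode_smul hmH
  let ν : A → A := fun a => antipode k (∑ j ∈ (ℛ k a).index,
    mA (antipode k ((ℛ k a).left j)) • antipode k ((ℛ k a).right j))
  have hνA : ∀ x a, lA (x * a) = lA (ν a * x) := fun x a => hnA _ hαA a _ (ℛ k a) x
  -- The only place where equality of the modular functions enters: `i ∘ ν` is the commutation rule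
  -- of `lH` on the image of `A`.
  have hνH : ∀ x a, lH (x * i a) = lH (i (ν a) * x) := fun x a => by
    have hr : ∑ j ∈ (ℛ k a).index, i ((ℛ k a).left j) ⊗ₜ[k] i ((ℛ k a).right j) =
        comul (R := k) (i a) := by
      rw [← CoalgHomClass.map_comp_comul_apply, ← (ℛ k a).eq]
      simp
    refine (hnH _ hαH (i a) _ ⟨(ℛ k a).index, fun j => i ((ℛ k a).left j),
      fun j => i ((ℛ k a).right j), hr⟩ x).trans ?_
    simp only [ν, hS, map_sum, map_smul, ← h]
  obtain ⟨E, hE, hEl⟩ := hlA.exists_coinduced (i : A →ₐ[k] H) lH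
  replace hE : ∀ a h, lA (a * E h) = lH (i a * h) := hE
  replace hEl : ∀ a h, E (i a * h) = a * E h := hEl
  have hEr : ∀ h a, E (h * i a) = E h * a := fun h a => hlA.ext_left fun b => by
    rw [hE, ← mul_assoc, hνH, ← mul_assoc, ← map_mul, ← hE, mul_assoc, ← hνA, mul_assoc]
  have hE1 : ∀ h, lA (E h) = lH h := fun h => by
    simpa using hE 1 h
  obtain ⟨n, φ, e, hφ, he⟩ := exists_projective_basis hi hS
  -- Representing `lA ∘ φⱼ` as `lH(· zⱼ)` gives `φⱼ = E(· zⱼ)`, so one dual basis identity is the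
  -- projective basis identity. The other is tested against `lH(b ·)` by expanding `b`.
  choose z hz using fun j => hlH.exists_right (lA ∘ₗ φ j)
  have hφz : ∀ j h, φ j h = E (h * z j) := fun j h => hlA.ext_left fun b => by
    rw [← hφ, hE, ← mul_assoc]
    exact hz j _
  refine ⟨E.toAddMonoidHom, hEl, hEr, n, z, e, fun a => ⟨hlH.ext_left fun b => ?_, ?_⟩⟩
  · change lH (b * ∑ j, z j * i (E (e j * a))) = _
    rw [Finset.mul_sum, map_sum, ← he b, Finset.sum_mul, map_sum, he]
    refine Finset.sum_congr rfl fun j _ => ?_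
    rw [← hE1, ← mul_assoc, hEr, hφz, ← hE1, mul_assoc, hEl]
  · change ∑ j, i (E (a * z j)) * e j = a
    simp only [← hφz, he]

end HopfRep

/-! ### Relative integrals for a Hopf subalgebra -/

namespace HopfSubalgebra

open HopfRep

universe u

variable {k : Type*} {H : Type u} [Field k] [Ring H] [HopfAlgebra k H]

/-- The inclusion of a Hopf subalgebra. -/
noncomputable def inclusion (R : HopfSubalgebra k H) : R.toSubalgebra →ₐc[k] H :=
  BialgHom.ofAlgHom R.toSubalgebra.val (AlgHom.ext fun _ => rfl)
    (AlgHom.ext R.tensorVal_comul)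

theorem inclusion_injective (R : HopfSubalgebra k H) : Function.Injective R.inclusion :=
  Subtype.val_injective

theorem inclusion_antipode (R : HopfSubalgebra k H) (r : R.toSubalgebra) :
    R.inclusion (antipode k r) = antipode k (R.inclusion r) := rfl

theorem augmentationRightIdeal_eq (R : HopfSubalgebra k H) : R.augmentationRightIdeal =
    Submodule.span Hᵐᵒᵖ (R.inclusion '' {r | counit (R := k) r = 0}) := by
  unfold augmentationRightIdeal
  congr 1
  refine Set.ext fun h => ⟨fun hh => ⟨⟨h, hh.1⟩, hh.2, rfl⟩, ?_⟩
  rintro ⟨r, hr, rfl⟩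
  exact ⟨r.2, hr⟩

theorem mul_eq_zero_iff_mem [FiniteDimensional k H] (R : HopfSubalgebra k H) {t : R.toSubalgebra}
    (ht : IsRightIntegral k t) (h0 : t ≠ 0) (h : H) :
    (t : H) * h = 0 ↔ h ∈ R.augmentationRightIdeal := by
  refine ⟨fun hh => ?_, fun hh => ?_⟩
  · rw [augmentationRightIdeal_eq]
    exact mem_span_of_mul_eq_zero R.inclusion_injective R.inclusion_antipode ht h0 hh
  · induction hh using Submodule.span_induction with
    | mem x hx =>
      have h1 : counit (R := k) (⟨x, hx.1⟩ : R.toSubalgebra) = 0 := hx.2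
      have h2 := ht ⟨x, hx.1⟩
      rw [h1, zero_smul] at h2
      exact congrArg Subtype.val h2
    | zero => simp
    | add x y _ _ hx hy => rw [mul_add, hx, hy, add_zero]
    | smul a x _ hx =>
      change (t : H) * (x * a.unop) = 0
      rw [← mul_assoc, hx, zero_mul]

/-- Left multiplication by `t` has kernel `R⁺H`, so it embeds `Q` in `H` as a right module. -/
theorem isRightRelativeIntegral_mk_iff [FiniteDimensional k H] (R : HopfSubalgebra k H)
    {t : R.toSubalgebra} (ht : IsRightIntegral k t) (h0 : t ≠ 0) (x : H) :
    R.IsRightRelativeIntegral (Submodule.Quotient.mk x) ↔ IsRightIntegral k ((t : H) * x) := by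
  refine forall_congr' fun h => ?_
  change (Submodule.Quotient.mk (x * h) : R.Quot) = Submodule.Quotient.mk (counit (R := k) h • x) ↔ _
  rw [Submodule.Quotient.eq, ← R.mul_eq_zero_iff_mem ht h0, mul_sub, sub_eq_zero, mul_smul_comm,
    mul_assoc]

theorem exists_isRightRelativeIntegral_iff [FiniteDimensional k H] (R : HopfSubalgebra k H)
    {mH : H → k} {mR : R.toSubalgebra → k} (hmH : IsRightModularFunction k mH)
    (hmR : IsRightModularFunction k mR) :
    (∃ t : R.Quot, t ≠ 0 ∧ R.IsRightRelativeIntegral t) ↔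
      ∀ r : R.toSubalgebra, mH (r : H) = mR r := by
  obtain ⟨t, h0, ht⟩ := exists_isRightIntegral k R.toSubalgebra
  have hne : ∀ x : H, (Submodule.Quotient.mk x : R.Quot) ≠ 0 ↔ (t : H) * x ≠ 0 := fun x => by
    rw [Ne, Submodule.Quotient.mk_eq_zero, ← R.mul_eq_zero_iff_mem ht h0]
  constructor
  · rintro ⟨x, hx0, hx⟩ r
    obtain ⟨x, rfl⟩ := Submodule.Quotient.mk_surjective _ x
    rw [R.isRightRelativeIntegral_mk_iff ht h0] at hx
    rw [hne] at hx0
    refine smul_left_injective k hx0 ?_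
    change mH (r : H) • ((t : H) * x) = mR r • ((t : H) * x)
    rw [← hmH _ hx, ← mul_assoc, ← smul_mul_assoc]
    exact congrArg (· * x) (congrArg Subtype.val (hmR t ht r))
  · intro h
    obtain ⟨Λ, hΛ0, hΛ⟩ := exists_isRightIntegral k H
    obtain ⟨w, rfl⟩ := exists_eq_mul_of_mul_eq R.inclusion_injective R.inclusion_antipode h0 mR
      (hmR t ht) (x := Λ) fun r => by rw [← h, ← hmH _ hΛ]; rfl
    exact ⟨Submodule.Quotient.mk w, (hne w).2 hΛ0,
      (R.isRightRelativeIntegral_mk_iff ht h0 w).2 hΛ⟩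

/-- The witness is the class of `u = ∑ ε(xᵢ) yᵢ`. It is nonzero because `ε ∘ E` kills `R⁺H`, whereas
`ε(E(u)) = ε(∑ xᵢ E(yᵢ)) = 1`. -/
theorem exists_isRightRelativeIntegral_of_isFrobeniusExtension (R : HopfSubalgebra k H)
    (h : IsFrobeniusExtension R.toSubalgebra.val.toRingHom) :
    ∃ t : R.Quot, t ≠ 0 ∧ R.IsRightRelativeIntegral t := by
  obtain ⟨E, hEl, hEr, n, x, y, hxy⟩ := h
  replace hxy : ∀ a : H, ∑ i, x i * (E (y i * a) : H) = a ∧ ∑ i, (E (a * x i) : H) * y i = a := hxy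
  replace hEl : ∀ (b : R.toSubalgebra) (a : H), E ((b : H) * a) = b * E a := hEl
  have hε : ∀ (r : R.toSubalgebra) (h : H), (Submodule.Quotient.mk ((r : H) * h) : R.Quot) =
      Submodule.Quotient.mk (counit (R := k) (r : H) • h) := fun r h => by
    rw [Submodule.Quotient.eq]
    have h1 : (r : H) * h - counit (R := k) (r : H) • h =
        op h • ((r : H) - algebraMap k H (counit (r : H))) := by
      rw [op_smul_eq_mul, sub_mul, Algebra.smul_def]
    rw [h1]
    refine Submodule.smul_mem _ _ (Submodule.subset_span
      ⟨sub_mem r.2 (R.toSubalgebra.algebraMap_mem _), ?_⟩)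
    rw [map_sub, Bialgebra.counit_algebraMap, sub_self]
  have hmem : ∀ h ∈ R.augmentationRightIdeal, ∀ g : H,
      counit (R := k) (E (h * g) : H) = 0 := fun h hh => by
    induction hh using Submodule.span_induction with
    | mem x hx =>
      intro g
      rw [show E (x * g) = _ from hEl ⟨x, hx.1⟩ g]
      exact (Bialgebra.counit_mul _ _).trans (by rw [hx.2, zero_mul])
    | zero => simp
    | add x y _ _ hx hy =>
      intro g
      rw [add_mul, map_add, Subalgebra.coe_add, map_add, hx, hy, add_zero]
    | smul a x _ hx =>
      intro g
      rw [show a • x = x * a.unop from rfl, mul_assoc]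
      exact hx _
  -- `E` is only assumed additive; `k`-linearity comes from `R`-linearity.
  have hsmul : ∀ (c : k) (h : H), (E (c • h) : H) = c • (E h : H) := fun c h => by
    have h1 := hEl (algebraMap k R.toSubalgebra c) h
    rw [← Algebra.smul_def] at h1
    rw [Algebra.smul_def]
    exact congrArg Subtype.val h1
  refine ⟨Submodule.Quotient.mk (∑ i, counit (R := k) (x i) • y i), fun h0 => ?_, fun h => ?_⟩
  · have h1 := hmem _ ((Submodule.Quotient.mk_eq_zero _).1 h0) 1
    have h2 := congrArg (counit (R := k)) (hxy 1).1
    simp only [mul_one, map_sum, AddSubmonoidClass.coe_finsetSum, hsmul, map_smul, smul_eq_mul]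
      at h1
    simp only [mul_one, map_sum, Bialgebra.counit_mul, h1, Bialgebra.counit_one] at h2
    exact zero_ne_one h2
  · change (Submodule.Quotient.mk ((∑ i, counit (R := k) (x i) • y i) * h) : R.Quot) =
      Submodule.Quotient.mk (counit (R := k) h • ∑ i, counit (R := k) (x i) • y i)
    -- One dual basis identity expands `yᵢ h` modulo `R⁺H`; the other, applied to `h xⱼ` under `ε`,
    -- sums the coefficients to `ε(h) ε(xⱼ)`.
    have h1 : ∀ i, (Submodule.Quotient.mk (y i * h) : R.Quot) = ∑ j,
        Submodule.Quotient.mk (counit (R := k) (E (y i * h * x j) : H) • y j) := fun i => by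
      conv_lhs => rw [← (hxy (y i * h)).2]
      rw [← Submodule.mkQ_apply, map_sum]
      exact Finset.sum_congr rfl fun j _ => hε _ _
    have h2 : ∀ j, ∑ i, counit (R := k) (x i) * counit (R := k) (E (y i * h * x j) : H) =
        counit (R := k) h * counit (R := k) (x j) := fun j => by
      rw [← Bialgebra.counit_mul, ← (hxy (h * x j)).1, map_sum]
      simp only [Bialgebra.counit_mul, mul_assoc]
    simp only [Finset.sum_mul, smul_mul_assoc, Finset.smul_sum, smul_smul, ← h2]
    simp only [← Submodule.mkQ_apply] at h1 ⊢
    simp only [map_sum, Finset.sum_smul, mul_smul]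
    rw [Finset.sum_comm]
    refine Finset.sum_congr rfl fun i _ => ?_
    rw [show R.augmentationRightIdeal.mkQ (counit (R := k) (x i) • (y i * h)) =
      counit (R := k) (x i) • R.augmentationRightIdeal.mkQ (y i * h) from rfl, h1,
      Finset.smul_sum]
    rfl

end HopfSubalgebra

theorem mainTheorem1 {k : Type*} {H : Type*} [Field k] [Ring H] [HopfAlgebra k H]
    [FiniteDimensional k H] (R : HopfSubalgebra k H) :
    (∃! mH : H → k, IsRightModularFunction k mH) ∧
    (∃! mR : R.toSubalgebra → k, IsRightModularFunction k mR) ∧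
    ((∃ t : R.Quot, t ≠ 0 ∧ R.IsRightRelativeIntegral t) ↔
      IsFrobeniusExtension R.toSubalgebra.val.toRingHom) ∧
    (IsFrobeniusExtension R.toSubalgebra.val.toRingHom ↔
      ∀ (mH : H → k) (mR : R.toSubalgebra → k),
        IsRightModularFunction k mH → IsRightModularFunction k mR →
          ∀ r : R.toSubalgebra, mH (r : H) = mR r) := by
  obtain ⟨mH, hmH, hH⟩ := HopfRep.existsUnique_isRightModularFunction k H
  obtain ⟨mR, hmR, hR⟩ := HopfRep.existsUnique_isRightModularFunction k R.toSubalgebra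
  have h1 := R.exists_isRightRelativeIntegral_of_isFrobeniusExtension
  have h2 := R.exists_isRightRelativeIntegral_iff hmH hmR
  have h3 : (∀ r : R.toSubalgebra, mH (r : H) = mR r) →
      IsFrobeniusExtension R.toSubalgebra.val.toRingHom :=
    HopfRep.isFrobeniusExtension_of_modular_eq R.inclusion_injective R.inclusion_antipode hmR hmH
  refine ⟨⟨mH, hmH, hH⟩, ⟨mR, hmR, hR⟩, ⟨fun h => h3 (h2.1 h), h1⟩, fun h mH' mR' hm hm' => ?_,
    fun h => h3 (h mH mR hmH hmR)⟩
  exact (R.exists_isRightRelativeIntegral_iff hm hm').1 (h1 h)
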